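/- For $n\ge 1$ let $\lambda$ be the Lebesgue (uniform product) measure on $n^\omega=\{0,\dots,n-1\}^\omega$. A sequence $x\in n^\omega$ is Martin-Löf random if $x\notin\bigcap_i U_i$ for every uniformly $\Sigma^0_1$ sequence $(U_i)_{i\in\omega}$ of subsets of $n^\omega$ with $\lambda(U_i)\le 2^{-i}$ for all $i$. *Random closed sets.* For $x\in 3^\omega$ let $T_x\subseteq 2^{<\omega}$ be the tree defined inductively as follows: the empty string is in $T_x$; if $\sigma$ is the $(i+1)$-st node of $T_x$ in the length-lexicographic order, then exactly $\sigma0$, exactly $\sigma1$, or both of these belong to $T_x$, according to whether $x(i)=0$, $x(i)=1$ or $x(i)=2$. A set $C\subseteq 2^\omega$ is a random closed set if $C=[T_x]$, the set of infinite paths through $T_x$, for some Martin-Löf random $x\in 3^\omega$. *Random continuous functions.* Let $\sigma_0,\sigma_1,\sigma_2,\dots$ be the length-lexicographic enumeration of $2^{<\omega}$, with $\sigma_0$ the empty string. For $x\in 3^\omega$ label each $\sigma_i$ with $i\ge1$ by $\ell_x(\sigma_i)=x(i-1)$. Let $F_x$ be the partial function from $2^\omega$ to $2^\omega$ for which $F_x(y)$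 is the result of deleting all $2$'s from the sequence $\ell_x(y{\restriction}1),\ell_x(y{\restriction}2),\dots$; it is defined if and only if infinitely many digits remain. A random continuous function is a function of the form $F_x$ with $x\in 3^\omega$ Martin-Löf random. A function $\delta:2^\omega\to2^\omega$ is a pseudo-distance function for $C\subseteq 2^\omega$ if $C=\{y\in 2^\omega:\delta(y)=0^\omega\}$. **Statement.** Let $C\subseteq 2^\omega$ be a non-empty closed set. There is a (total) function $\delta:2^\omega\to2^\omega$ that is both a random continuous function and a pseudo-distance function for $C$ if and only if $C$ is a random closed set. -/

import Mathlib

open MeasureTheory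
open scoped ENNReal

namespace AlgRandom

/-- The space `n^ω` of infinite sequences over the alphabet `{0, …, n-1}`,
with the product topology and the product (Borel) `σ`-algebra. -/
abbrev Seq (n : ℕ) : Type := ℕ → Fin n

/-- The initial segment `x ↾ k` of length `k`. -/
def initSeg {n : ℕ} (x : Seq n) (k : ℕ) : List (Fin n) := (List.range k).map x

/-- The basic clopen set `⟦σ⟧` of all sequences that extend the finite string `σ`. -/
def basicClopen {n : ℕ} (σ : List (Fin n)) : Set (Seq n) := {x | initSeg x σ.length = σ}

/-- The Lebesgue measure on `n^ω`: the infinite product of the uniform measures on the alphabet,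
so that `⟦σ⟧` has measure `n^(-|σ|)`. -/
noncomputable def lebesgue (n : ℕ) [NeZero n] : Measure (Seq n) :=
  Measure.infinitePi fun _ : ℕ => (PMF.uniformOfFintype (Fin n)).toMeasure

/-- A uniformly `Σ⁰₁` sequence of subsets of `n^ω`: one computably enumerable set of pairs `(i, σ)`
such that the `i`-th set is the union of the `⟦σ⟧` for the pairs `(i, σ)` enumerated. -/
def UniformlySigma01 {n : ℕ} (U : ℕ → Set (Seq n)) : Prop :=
  ∃ W : ℕ × List (Fin n) → Prop, REPred W ∧ ∀ i, U i = {x | ∃ σ, W (i, σ) ∧ x ∈ basicClopen σ}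

/-- `μ`-Martin-Löf tests. -/
structure IsMLTest {n : ℕ} (μ : Measure (Seq n)) (U : ℕ → Set (Seq n)) : Prop where
  uniform : UniformlySigma01 U
  small : ∀ i, μ (U i) ≤ (2⁻¹ : ℝ≥0∞) ^ i

/-- The set of `μ`-Martin-Löf random sequences (for a computable measure `μ`). -/
def MLR {n : ℕ} (μ : Measure (Seq n)) : Set (Seq n) :=
  {x | ∀ U : ℕ → Set (Seq n), IsMLTest μ U → x ∉ ⋂ i, U i}

/-! ### Closed sets coded by sequences over `{0, 1, 2}` -/

/-- The immediate successors of the node `σ` when it carries the code digit `d`: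
only `σ0` if `d = 0`, only `σ1` if `d = 1`, both if `d = 2`. -/
def children (d : Fin 3) (σ : List (Fin 2)) : List (List (Fin 2)) :=
  match d with
  | 0 => [σ ++ [0]]
  | 1 => [σ ++ [1]]
  | 2 => [σ ++ [0], σ ++ [1]]

/-- The `k`-th level of the tree `T_x`: the list, in lexicographic order, of its nodes of length
`k`, together with the number of its nodes of length less than `k`. Nodes are counted in
length-lexicographic order, and the node with exactly `i` predecessors uses the digit `x i`. -/
def treeLevel (x : Seq 3) : ℕ → List (List (Fin 2)) × ℕ
  | 0 => ([[]], 0)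
  | k + 1 =>
    (((treeLevel x k).1.zipIdx (treeLevel x k).2).flatMap fun p => children (x p.2) p.1,
      (treeLevel x k).2 + (treeLevel x k).1.length)

/-- The binary tree without dead ends `T_x` coded by `x ∈ 3^ω`. -/
def codedTree (x : Seq 3) : Set (List (Fin 2)) := {σ | σ ∈ (treeLevel x σ.length).1}

/-- The set `[T]` of infinite paths through `T`. -/
def paths (T : Set (List (Fin 2))) : Set (Seq 2) := {y | ∀ k, initSeg y k ∈ T}

/-- Random closed sets: the sets `[T_x]` for Martin-Löf random `x ∈ 3^ω`. -/
def IsRandomClosedSet (C : Set (Seq 2)) : Prop :=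
  ∃ x ∈ MLR (lebesgue 3), C = paths (codedTree x)

/-! ### Continuous functions coded by sequences over `{0, 1, 2}` -/

/-- The position of `σ` in the length-lexicographic enumeration `ε, 0, 1, 00, 01, 10, 11, 000, …`
of the finite binary strings, counted from `0`. -/
def strIndex (σ : List (Fin 2)) : ℕ := σ.foldl (fun i b => 2 * i + 1 + (b : ℕ)) 0

/-- The label that `x` gives to the nonempty string `σ`: if `σ` is the string with index `i ≥ 1`,
this is the digit `x (i - 1)`. -/
def label (x : Seq 3) (σ : List (Fin 2)) : Fin 3 := x (strIndex σ - 1)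

/-- The labels `ℓ_x (y ↾ 1), ℓ_x (y ↾ 2), …` read along `y`. -/
def labelSeq (x : Seq 3) (y : Seq 2) : Seq 3 := fun k => label x (initSeg y (k + 1))

/-- The partial function `F_x`: the value at `y` is what remains of the sequence of labels along
`y` after the removal of all `2`s, and it is defined iff infinitely many digits remain. -/
noncomputable def codedFun (x : Seq 3) : Seq 2 →. Seq 2 := fun y =>
  ⟨{k | labelSeq x y k ≠ 2}.Infinite,
    fun _ j => if labelSeq x y (Nat.nth (fun k => labelSeq x y k ≠ 2) j) = 1 then 1 else 0⟩

/-- Random continuous functions: the functions `F_x` for Martin-Löf random `x ∈ 3^ω`. -/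
def IsRandomContinuousFunction (F : Seq 2 →. Seq 2) : Prop :=
  ∃ x ∈ MLR (lebesgue 3), F = codedFun x

/-- `δ` is a pseudo-distance function for `C` if `C` is its set of zeros, i.e. of the points that
are mapped to `0^ω`. -/
def IsPseudoDistance (δ : Seq 2 → Seq 2) (C : Set (Seq 2)) : Prop :=
  C = {y | δ y = fun _ => 0}

end AlgRandom

namespace AlgRandom

/-! ### Initial segments and finite strings -/

/-! The zeros of F_x are the y along which the label 1 never occurs. They are the paths through the
tree of strings that meet no label 1 (`Good`) and can be extended arbitrarily far without meeting
one (`Alive`). For uniform x each label differs from 1 independently with probability 2/3, so this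
tree comes from a branching process, whose survival probability is the nonzero root 3/4 of p =
(4/3)p − (4/9)p². A given child is therefore permitted and surviving with probability 2/3 · 3/4 =
1/2. Each of the three nonempty sets of surviving children has probability 1/4, and 1/3 given that
the parent survives. These are exactly the digits of a uniform code: by `map_aliveCode`, passing
from x to the code of its surviving tree carries λ restricted to survival to (3/4)λ.

It remains to transfer Martin-Löf randomness along `aliveCode`. Survival concerns infinitely many
levels, but checking it only `lookahead` levels ahead errs with probability at most 2^(-i)
(`measure_not_reliable`). Outside that error set the graph of `aliveCode` agrees with the
effectively closed relation `CodesRel i`. Compactness (`uniformlySigma01_forall`) then pulls a test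
on codes back to a test on x (`aliveCode_mem_MLR`). Conversely it pushes the universal test forward,
so that every random code comes from a random x (`exists_codes_of_mem_MLR`).

Totality of F_x for random x is `infinite_labelSeq_ne_two`: a string has 2^k extensions by k
symbols, each labelled entirely by 2 with probability 3^(-k), and (2/3)^k tends to 0 effectively. -/

@[simp] theorem length_initSeg {n : ℕ} (x : Seq n) (k : ℕ) : (initSeg x k).length = k := by
  simp [initSeg]

theorem initSeg_eq_initSeg {n : ℕ} {x y : Seq n} {k : ℕ} :
    initSeg x k = initSeg y k ↔ ∀ i < k, x i = y i := by
  simp [initSeg]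

theorem take_initSeg {n : ℕ} (x : Seq n) {k l : ℕ} (h : l ≤ k) :
    (initSeg x k).take l = initSeg x l := by
  rw [initSeg, ← List.map_take, List.take_range, min_eq_left h, initSeg]

theorem getD_initSeg {n : ℕ} (x : Seq n) {k i : ℕ} (h : i < k) (a : Fin n) :
    (initSeg x k).getD i a = x i := by
  simp [initSeg, h]

/-- The list of all strings of length `k` over the alphabet `{0, …, n-1}`. -/
def allStrings (n : ℕ) : ℕ → List (List (Fin n))
  | 0 => [[]]
  | k + 1 => (allStrings n k).flatMap fun σ => (List.finRange n).map fun a => σ ++ [a]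

theorem mem_allStrings {n : ℕ} {k : ℕ} {σ : List (Fin n)} :
    σ ∈ allStrings n k ↔ σ.length = k := by
  induction k generalizing σ with
  | zero => simp [allStrings]
  | succ k ih =>
    simp only [allStrings, List.mem_flatMap, List.mem_map, List.mem_finRange, true_and, ih]
    constructor
    · rintro ⟨τ, h, a, rfl⟩
      simp [h]
    · intro h
      have hne : σ ≠ [] := by
        rintro rfl
        simp at h
      exact ⟨σ.dropLast, by simp [h], σ.getLast hne, List.dropLast_append_getLast hne⟩

theorem nodup_allStrings (n k : ℕ) : (allStrings n k).Nodup := by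
  induction k with
  | zero => simp [allStrings]
  | succ k ih =>
    rw [allStrings, List.nodup_flatMap]
    refine ⟨fun σ _ => (List.nodup_finRange n).map fun a b h => by simpa using h, ih.imp ?_⟩
    intro σ τ hne
    simp only [Function.onFun, List.disjoint_left, List.mem_map, List.mem_finRange, true_and]
    rintro _ ⟨a, rfl⟩ ⟨b, h⟩
    exact hne (List.append_inj_left' h rfl).symm

theorem primrec_allStrings (n : ℕ) : Primrec (allStrings n) := by
  have : Primrec fun k : ℕ => Nat.rec (motive := fun _ => List (List (Fin n))) [[]]
      (fun _ L => L.flatMap fun σ => (List.finRange n).map fun a => σ ++ [a]) k := by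
    refine Primrec.nat_rec' (f := fun k : ℕ => k) (g := fun _ => [[]])
      (h := fun _ p => p.2.flatMap fun σ => (List.finRange n).map fun a => σ ++ [a])
      Primrec.id (Primrec.const _) ?_
    refine Primrec.list_flatMap (Primrec.snd.comp Primrec.snd) ?_
    refine Primrec.list_map (Primrec.const _) ?_
    exact Primrec.list_concat.comp (Primrec.snd.comp Primrec.fst) Primrec.snd
  refine this.of_eq fun k => ?_
  induction k with
  | zero => rfl
  | succ k ih => simp only [ih, allStrings]

/-! ### Bounded quantifiers -/

theorem primrecPred_exists_mem {α β : Type*} [Primcodable α] [Primcodable β] {f : α → List β}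
    {p : α → β → Prop} (hf : Primrec f) (hp : PrimrecPred fun q : α × β => p q.1 q.2) :
    PrimrecPred fun a => ∃ b ∈ f a, p a b := by
  have h : PrimrecRel fun (b : β) (a : α) => p a b :=
    hp.comp (Primrec.snd.pair Primrec.fst)
  exact h.exists_mem_list.comp hf Primrec.id

theorem primrecPred_forall_mem {α β : Type*} [Primcodable α] [Primcodable β] {f : α → List β}
    {p : α → β → Prop} (hf : Primrec f) (hp : PrimrecPred fun q : α × β => p q.1 q.2) :
    PrimrecPred fun a => ∀ b ∈ f a, p a b := by
  have h : PrimrecRel fun (b : β) (a : α) => p a b :=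
    hp.comp (Primrec.snd.pair Primrec.fst)
  exact h.forall_mem_list.comp hf Primrec.id

theorem primrecPred_exists_lt {α : Type*} [Primcodable α] {f : α → ℕ}
    {p : α → ℕ → Prop} (hf : Primrec f) (hp : PrimrecPred fun q : α × ℕ => p q.1 q.2) :
    PrimrecPred fun a => ∃ b < f a, p a b := by
  refine (primrecPred_exists_mem (Primrec.list_range.comp hf) hp).of_eq fun a => ?_
  simp

theorem primrecPred_forall_lt {α : Type*} [Primcodable α] {f : α → ℕ}
    {p : α → ℕ → Prop} (hf : Primrec f) (hp : PrimrecPred fun q : α × ℕ => p q.1 q.2) :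
    PrimrecPred fun a => ∀ b < f a, p a b := by
  refine (primrecPred_forall_mem (Primrec.list_range.comp hf) hp).of_eq fun a => ?_
  simp

theorem primrecPred_imp {α : Type*} [Primcodable α] {p q : α → Prop} (hp : PrimrecPred p)
    (hq : PrimrecPred q) : PrimrecPred fun a => p a → q a := by
  classical
  exact (hp.not.or hq).of_eq fun a => by tauto

/-! ### Stagewise enumeration of uniformly `Σ⁰₁` sequences -/

open Nat.Partrec (Code)

/-- The string `s` has an initial segment `τ` such that the program `c` halts on `(i, τ)` within
`|s|` steps. -/
def Hits {n : ℕ} (c : Code) (i : ℕ) (s : List (Fin n)) : Prop :=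
  ∃ l < s.length + 1, (c.evaln s.length (Encodable.encode (i, s.take l))).isSome

theorem primrecPred_hits {n : ℕ} :
    PrimrecPred fun p : Code × ℕ × List (Fin n) => Hits p.1 p.2.1 p.2.2 := by
  unfold Hits
  refine primrecPred_exists_lt (f := fun p : Code × ℕ × List (Fin n) => p.2.2.length + 1)
    (p := fun p l => (p.1.evaln p.2.2.length (Encodable.encode (p.2.1, p.2.2.take l))).isSome)
    (Primrec.succ.comp (Primrec.list_length.comp (Primrec.snd.comp Primrec.snd))) ?_
  have hs : Primrec fun q : (Code × ℕ × List (Fin n)) × ℕ => q.1.2.2 :=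
    Primrec.snd.comp (Primrec.snd.comp Primrec.fst)
  have : Primrec fun q : (Code × ℕ × List (Fin n)) × ℕ =>
      (q.1.1.evaln q.1.2.2.length (Encodable.encode (q.1.2.1, q.1.2.2.take q.2))).isSome := by
    refine Primrec.option_isSome.comp (Nat.Partrec.Code.primrec_evaln.comp
      (((Primrec.list_length.comp hs).pair (Primrec.fst.comp Primrec.fst)).pair
        (Primrec.encode.comp ((Primrec.fst.comp (Primrec.snd.comp Primrec.fst)).pair
          (Primrec.list_take.comp Primrec.snd hs)))))
  exact ⟨inferInstance, this.of_eq fun q => (Bool.decide_coe _).symm⟩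

/-- The length of the string bounds both the prefixes tried and the running time, so a longer
initial segment can only find more. -/
theorem Hits.mono {n : ℕ} {c : Code} {i : ℕ} {x : Seq n} {k l : ℕ} (hkl : k ≤ l)
    (h : Hits c i (initSeg x k)) : Hits c i (initSeg x l) := by
  obtain ⟨j, hj, h⟩ := h
  rw [length_initSeg] at hj h
  refine ⟨j, by simp; omega, ?_⟩
  rw [take_initSeg x (by omega)] at h ⊢
  rw [length_initSeg]
  obtain ⟨v, hv⟩ := Option.isSome_iff_exists.1 h
  exact Option.isSome_iff_exists.2 ⟨v, Nat.Partrec.Code.evaln_mono hkl hv⟩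

theorem mem_basicClopen {n : ℕ} {x : Seq n} {σ : List (Fin n)} :
    x ∈ basicClopen σ ↔ initSeg x σ.length = σ := Iff.rfl

/-- Normal form: each U_i becomes an increasing union over m of clopen sets, membership in which is
decided by the string of length m alone. -/
theorem UniformlySigma01.exists_code {n : ℕ} {U : ℕ → Set (Seq n)} (h : UniformlySigma01 U) :
    ∃ c : Code, ∀ i, U i = {x | ∃ m, Hits c i (initSeg x m)} := by
  obtain ⟨W, hW, hU⟩ := h
  obtain ⟨c, hc⟩ := Nat.Partrec.Code.exists_code.1 hW
  have key : ∀ a : ℕ × List (Fin n), W a ↔ ∃ k, (c.evaln k (Encodable.encode a)).isSome := by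
    intro a
    have h1 : W a ↔ (c.eval (Encodable.encode a)).Dom := by
      rw [hc]
      simp [Part.assert]
    rw [h1, Part.dom_iff_mem]
    simp only [Nat.Partrec.Code.evaln_complete, Option.isSome_iff_exists]
    exact exists_comm
  refine ⟨c, fun i => ?_⟩
  rw [hU]
  ext x
  simp only [Set.mem_ofPred_eq, mem_basicClopen, key]
  constructor
  · rintro ⟨σ, ⟨k, hk⟩, hx⟩
    refine ⟨max k σ.length, σ.length, by simp, ?_⟩
    rw [take_initSeg x (le_max_right _ _), hx, length_initSeg]
    obtain ⟨v, hv⟩ := Option.isSome_iff_exists.1 hk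
    exact Option.isSome_iff_exists.2 ⟨v, Nat.Partrec.Code.evaln_mono (le_max_left _ _) hv⟩
  · rintro ⟨m, l, hl, h⟩
    rw [length_initSeg] at hl h
    rw [take_initSeg x (by omega)] at h
    exact ⟨initSeg x l, ⟨m, h⟩, by simp⟩

theorem uniformlySigma01_of_primrecPred {n : ℕ} {P : ℕ → List (Fin n) → Prop}
    (hP : PrimrecPred fun p : ℕ × List (Fin n) => P p.1 p.2) :
    UniformlySigma01 fun i => {x : Seq n | ∃ m, P i (initSeg x m)} := by
  refine ⟨fun p => P p.1 p.2, ComputablePred.to_re ⟨hP.choose, hP.choose_spec.to_comp⟩, fun i => ?_⟩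
  ext x
  simp only [Set.mem_ofPred_eq, mem_basicClopen]
  constructor
  · rintro ⟨m, hm⟩
    exact ⟨_, hm, by simp⟩
  · rintro ⟨σ, hσ, hx⟩
    exact ⟨σ.length, by rwa [hx]⟩

/-! ### Finite strings as sequences, and the measure of sets given by initial segments -/

/-- The sequence obtained from the string `s` by appending `0`s. -/
def extend {n : ℕ} [NeZero n] (s : List (Fin n)) : Seq n := fun i => s.getD i 0

theorem initSeg_extend {n : ℕ} [NeZero n] (s : List (Fin n)) : initSeg (extend s) s.length = s := by
  refine List.ext_getElem (by simp) fun i h1 h2 => ?_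
  simp [initSeg, extend, h2]

theorem extend_initSeg {n : ℕ} [NeZero n] (x : Seq n) {m i : ℕ} (h : i < m) :
    extend (initSeg x m) i = x i := getD_initSeg x h 0

theorem isClopen_initSeg {n : ℕ} (k : ℕ) (P : List (Fin n) → Prop) :
    IsClopen {x : Seq n | P (initSeg x k)} := by
  have hc : Continuous fun (x : Seq n) (i : Fin k) => x i := by fun_prop
  have := (isClopen_discrete {f : Fin k → Fin n | P (List.ofFn f)}).preimage hc
  convert this using 1
  ext x
  simp only [Set.mem_preimage, Set.mem_ofPred_eq]
  rw [show List.ofFn (fun i : Fin k => x i) = initSeg x k from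
    List.ext_getElem (by simp) (by simp [initSeg])]

theorem measurableSet_initSeg {n : ℕ} (k : ℕ) (P : List (Fin n) → Prop) :
    MeasurableSet {x : Seq n | P (initSeg x k)} := (isClopen_initSeg k P).isOpen.measurableSet

instance {n : ℕ} [NeZero n] : IsProbabilityMeasure (lebesgue n) := by
  unfold lebesgue
  infer_instance

theorem lebesgue_coord {n : ℕ} [NeZero n] (s : Finset ℕ) (t : ℕ → Finset (Fin n)) :
    lebesgue n {x | ∀ i ∈ s, x i ∈ t i} = ∏ i ∈ s, ((t i).card : ℝ≥0∞) / n := by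
  have h := Measure.infinitePi_pi (μ := fun _ : ℕ => (PMF.uniformOfFintype (Fin n)).toMeasure)
    (s := s) (t := fun i => (t i : Set (Fin n))) fun i _ => (t i).measurableSet
  have h2 : ∀ i, (PMF.uniformOfFintype (Fin n)).toMeasure (t i : Set (Fin n)) =
      ((t i).card : ℝ≥0∞) / n := by
    intro i
    rw [PMF.toMeasure_uniformOfFintype_apply _ (t i).measurableSet]
    simp
  simp only [h2] at h
  rw [← h, lebesgue]
  rfl

theorem lebesgue_initSeg_eq {n : ℕ} [NeZero n] (s : List (Fin n)) :
    lebesgue n {x | initSeg x s.length = s} = ((n : ℝ≥0∞)⁻¹) ^ s.length := by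
  have h := lebesgue_coord (Finset.range s.length) fun i => {extend s i}
  simp only [Finset.mem_range, Finset.mem_singleton, Finset.card_singleton, Nat.cast_one,
    one_div, Finset.prod_const, Finset.card_range] at h
  rw [← h]
  congr 1
  ext x
  simp only [Set.mem_ofPred_eq]
  conv_lhs => rhs; rw [← initSeg_extend s]
  exact initSeg_eq_initSeg

theorem lebesgue_initSeg {n : ℕ} [NeZero n] (k : ℕ) (P : List (Fin n) → Prop) [DecidablePred P] :
    lebesgue n {x | P (initSeg x k)} =
      (((allStrings n k).filter (P ·)).length : ℝ≥0∞) * ((n : ℝ≥0∞)⁻¹) ^ k := by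
  have h : {x : Seq n | P (initSeg x k)} =
      ⋃ s ∈ ((allStrings n k).filter (P ·)).toFinset, {x | initSeg x k = s} := by
    ext x
    simp [mem_allStrings]
  rw [h, measure_biUnion_finset]
  · rw [Finset.sum_congr rfl (g := fun _ => ((n : ℝ≥0∞)⁻¹) ^ k)]
    · rw [Finset.sum_const, List.toFinset_card_of_nodup ((nodup_allStrings n k).filter _),
        nsmul_eq_mul]
    · intro s hs
      have : s.length = k := by
        simp only [List.mem_toFinset, List.mem_filter, mem_allStrings] at hs
        exact hs.1
      rw [← this, lebesgue_initSeg_eq]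
  · intro s _ t _ hst
    refine Set.disjoint_left.2 fun x hx hx' => hst ?_
    simp only [Set.mem_ofPred_eq] at hx hx'
    rw [← hx, hx']
  · exact fun s _ => measurableSet_initSeg k (· = s)

/-! ### A universal Martin-Löf test -/

open Nat.Partrec (Code)

/-- The strings of length `m` at which the `i`-th set enumerated by `c` has been hit
make up a set of measure at most `2^(-i)`. -/
def SmallAt (n : ℕ) (c : Code) (i m : ℕ) : Prop :=
  ∃ h : DecidablePred fun s : List (Fin n) => Hits c i s,
    ((allStrings n m).filter (fun s => @decide _ (h s))).length * 2 ^ i ≤ n ^ m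

/-- Counting strings turns the comparison of measures into an inequality between natural numbers, so
the cut-off in the universal test is decidable. -/
theorem smallAt_iff {n : ℕ} [NeZero n] (c : Code) (i m : ℕ) :
    SmallAt n c i m ↔ lebesgue n {x | Hits c i (initSeg x m)} ≤ (2⁻¹ : ℝ≥0∞) ^ i := by
  classical
  have hn : (n : ℝ≥0∞) ^ m ≠ 0 := pow_ne_zero _ (by simpa using NeZero.ne n)
  have hn' : (n : ℝ≥0∞) ^ m ≠ ∞ := ENNReal.pow_ne_top (ENNReal.natCast_ne_top n)
  rw [lebesgue_initSeg, ← ENNReal.inv_pow, ← ENNReal.inv_pow, ← div_eq_mul_inv,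
    ENNReal.div_le_iff_le_mul (Or.inl hn) (Or.inl hn'), mul_comm _ ((n : ℝ≥0∞) ^ m),
    ← div_eq_mul_inv, ENNReal.le_div_iff_mul_le (Or.inl (by simp)) (Or.inl (by simp))]
  constructor
  · rintro ⟨h, hh⟩
    obtain rfl : h = fun s => Classical.propDecidable _ := Subsingleton.elim _ _
    exact_mod_cast (Nat.cast_le (α := ℝ≥0∞)).2 hh
  · intro h
    refine ⟨fun s => Classical.propDecidable _, ?_⟩
    exact_mod_cast h

theorem primrec_pow : Primrec₂ fun a b : ℕ => a ^ b := by
  have : Primrec₂ (fun a n : ℕ => Nat.rec (motive := fun _ => ℕ) 1 (fun _ p => p * a) n) := by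
    refine Primrec.nat_rec (f := fun _ : ℕ => 1) (g := fun a q => q.2 * a) (Primrec.const 1) ?_
    exact Primrec.nat_mul.comp (Primrec.snd.comp Primrec.snd) Primrec.fst
  refine this.of_eq fun a n => ?_
  induction n with
  | zero => rfl
  | succ n ih => simp only [ih, pow_succ]

theorem primrecPred_smallAt (n : ℕ) :
    PrimrecPred fun p : Code × ℕ × ℕ => SmallAt n p.1 p.2.1 p.2.2 := by
  classical
  have hrel : PrimrecRel fun (s : List (Fin n)) (p : Code × ℕ × ℕ) => Hits p.1 p.2.1 s :=
    primrecPred_hits.comp ((Primrec.fst.comp Primrec.snd).pair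
      ((Primrec.fst.comp (Primrec.snd.comp Primrec.snd)).pair Primrec.fst))
  have hfil := hrel.listFilter
  have h1 : Primrec fun p : Code × ℕ × ℕ =>
      ((allStrings n p.2.2).filter fun s => decide (Hits p.1 p.2.1 s)).length :=
    Primrec.list_length.comp (hfil.comp
      ((primrec_allStrings n).comp (Primrec.snd.comp Primrec.snd)) Primrec.id)
  have h2 : PrimrecPred fun p : Code × ℕ × ℕ =>
      ((allStrings n p.2.2).filter fun s => decide (Hits p.1 p.2.1 s)).length * 2 ^ p.2.1
        ≤ n ^ p.2.2 :=
    Primrec.nat_le.comp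
      (Primrec.nat_mul.comp h1 (primrec_pow.comp (Primrec.const 2)
        (Primrec.fst.comp Primrec.snd)))
      (primrec_pow.comp (Primrec.const n) (Primrec.snd.comp Primrec.snd))
  refine h2.of_eq fun p => ⟨fun h => ⟨fun s => Classical.propDecidable _, ?_⟩, fun ⟨h, hh⟩ => ?_⟩
  · convert h
  · convert hh

/-- The universal test: the union over all programs `e` of the `(j+e+1)`-st sets that they
enumerate, each cut off before its measure exceeds `2^(-(j+e+1))`. -/
def universalTest (n : ℕ) (j : ℕ) : Set (Seq n) :=
  {x | ∃ m, ∃ e < (initSeg x m).length, Hits (Code.ofNatCode e) (j + e + 1) (initSeg x m) ∧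
    SmallAt n (Code.ofNatCode e) (j + e + 1) (initSeg x m).length}

theorem primrec_ofNatCode : Primrec Code.ofNatCode := by
  have : Primrec (Denumerable.ofNat Code) := Primrec.ofNat Code
  exact this.of_eq fun _ => rfl

theorem isMLTest_universalTest (n : ℕ) [NeZero n] : IsMLTest (lebesgue n) (universalTest n) := by
  constructor
  · refine uniformlySigma01_of_primrecPred (P := fun j s => ∃ e < s.length,
      Hits (Code.ofNatCode e) (j + e + 1) s ∧ SmallAt n (Code.ofNatCode e) (j + e + 1) s.length) ?_
    refine primrecPred_exists_lt (f := fun p : ℕ × List (Fin n) => p.2.length)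
      (p := fun p e => Hits (Code.ofNatCode e) (p.1 + e + 1) p.2 ∧
        SmallAt n (Code.ofNatCode e) (p.1 + e + 1) p.2.length)
      (Primrec.list_length.comp Primrec.snd) ?_
    have hc : Primrec fun q : (ℕ × List (Fin n)) × ℕ => Code.ofNatCode q.2 :=
      primrec_ofNatCode.comp Primrec.snd
    have hi : Primrec fun q : (ℕ × List (Fin n)) × ℕ => q.1.1 + q.2 + 1 :=
      Primrec.succ.comp (Primrec.nat_add.comp (Primrec.fst.comp Primrec.fst) Primrec.snd)
    have hs : Primrec fun q : (ℕ × List (Fin n)) × ℕ => q.1.2 := Primrec.snd.comp Primrec.fst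
    exact (primrecPred_hits.comp (hc.pair (hi.pair hs))).and
      ((primrecPred_smallAt n).comp (hc.pair (hi.pair (Primrec.list_length.comp hs))))
  · intro j
    have hsub : universalTest n j ⊆ ⋃ e : ℕ, ⋃ m : {m // SmallAt n (Code.ofNatCode e) (j + e + 1) m},
        {x | Hits (Code.ofNatCode e) (j + e + 1) (initSeg x m)} := by
      rintro x ⟨m, e, -, h1, h2⟩
      rw [length_initSeg] at h2
      exact Set.mem_iUnion.2 ⟨e, Set.mem_iUnion.2 ⟨⟨m, h2⟩, h1⟩⟩
    have hone : ∀ e : ℕ, lebesgue n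
        (⋃ m : {m // SmallAt n (Code.ofNatCode e) (j + e + 1) m},
          {x | Hits (Code.ofNatCode e) (j + e + 1) (initSeg x m)}) ≤ (2⁻¹ : ℝ≥0∞) ^ (j + e + 1) := by
      intro e
      -- The stages increase with m, so the measure of their union is a supremum, and every admitted
      -- stage satisfies the bound.
      have hmono : Monotone fun m : {m // SmallAt n (Code.ofNatCode e) (j + e + 1) m} =>
          {x : Seq n | Hits (Code.ofNatCode e) (j + e + 1) (initSeg x m)} :=
        fun a b hab x hx => Hits.mono hab hx
      rw [hmono.directed_le.measure_iUnion]
      exact iSup_le fun m => (smallAt_iff _ _ _).1 m.2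
    calc lebesgue n (universalTest n j) ≤ _ := measure_mono hsub
      _ ≤ ∑' e : ℕ, _ := measure_iUnion_le _
      _ ≤ ∑' e : ℕ, (2⁻¹ : ℝ≥0∞) ^ j * (2⁻¹ : ℝ≥0∞) ^ (e + 1) :=
        ENNReal.tsum_le_tsum fun e => (hone e).trans_eq (by rw [← pow_add]; rfl)
      _ = (2⁻¹ : ℝ≥0∞) ^ j := by
        rw [ENNReal.tsum_mul_left, ENNReal.tsum_geometric_add_one]
        rw [ENNReal.one_sub_inv_two, inv_inv, ENNReal.inv_mul_cancel (by simp) (by simp), mul_one]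

/-- A genuine test with program e is never cut off, so its component j+e+1 lies inside
`universalTest n j`. Missing a single component of the universal test is therefore enough. -/
theorem mem_MLR_of_notMem_universalTest {n : ℕ} [NeZero n] {x : Seq n} {j : ℕ}
    (h : x ∉ universalTest n j) : x ∈ MLR (lebesgue n) := by
  intro U hU hx
  obtain ⟨c, hc⟩ := hU.uniform.exists_code
  obtain ⟨e, rfl⟩ : ∃ e, Code.ofNatCode e = c := ⟨Encodable.encode c, Denumerable.ofNat_encode c⟩
  have hxi := Set.mem_iInter.1 hx (j + e + 1)
  rw [hc] at hxi
  obtain ⟨m, hm⟩ := hxi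
  -- The segment must be longer than e for the program e to be consulted.
  refine h ⟨max m (e + 1), e, by simp, hm.mono (le_max_left _ _), (smallAt_iff _ _ _).2 ?_⟩
  refine (measure_mono ?_).trans (hU.small _)
  rw [hc]
  exact fun y hy => ⟨_, hy⟩

/-! ### Projections of effectively closed relations -/

/-- Quantifying universally over a compact space preserves Σ⁰₁: if open conditions cover all z, then
a single stage m already covers every string t of length m. The condition A restricts x
independently of z. -/
theorem uniformlySigma01_forall {a b : ℕ} [NeZero b] {U : ℕ → Set (Seq b)}
    (hU : UniformlySigma01 U) (c : ℕ) {A : ℕ → List (Fin a) → Prop}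
    (hA : PrimrecPred fun p : ℕ × List (Fin a) => A p.1 p.2)
    (hAm : ∀ i x m l, m ≤ l → A i (initSeg x m) → A i (initSeg x l))
    {B : ℕ → List (Fin a) → List (Fin b) → Prop}
    (hB : PrimrecPred fun p : (ℕ × List (Fin a)) × List (Fin b) => B p.1.1 p.1.2 p.2)
    (hBm : ∀ i x z m l, m ≤ l → B i (initSeg x m) (initSeg z m) → B i (initSeg x l) (initSeg z l)) :
    UniformlySigma01 fun i => {x : Seq a | (∃ m, A i (initSeg x m)) ∧
      ∀ z, z ∈ U (i + c) ∨ ∃ m, B i (initSeg x m) (initSeg z m)} := by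
  obtain ⟨e, he⟩ := hU.exists_code
  have hP : PrimrecPred fun p : ℕ × List (Fin a) =>
      A p.1 p.2 ∧ ∀ t ∈ allStrings b p.2.length, Hits e (p.1 + c) t ∨ B p.1 p.2 t := by
    refine hA.and (primrecPred_forall_mem (f := fun p : ℕ × List (Fin a) =>
      allStrings b p.2.length) (p := fun p t => Hits e (p.1 + c) t ∨ B p.1 p.2 t)
      ((primrec_allStrings b).comp (Primrec.list_length.comp Primrec.snd)) ?_)
    exact (primrecPred_hits.comp ((Primrec.const e).pair
      ((Primrec.nat_add.comp (Primrec.fst.comp Primrec.fst) (Primrec.const c)).pair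
        Primrec.snd))).or hB
  convert uniformlySigma01_of_primrecPred (P := fun i s =>
    A i s ∧ ∀ t ∈ allStrings b s.length, Hits e (i + c) t ∨ B i s t) hP using 1
  funext i
  ext x
  simp only [he, Set.mem_ofPred_eq, mem_allStrings, length_initSeg]
  constructor
  · rintro ⟨⟨m, hm⟩, hz⟩
    by_contra! hcon
    -- If no stage suffices, the sets of z not yet covered are closed, nested and nonempty, and a
    -- common point contradicts `hz`.
    let K : ℕ → Set (Seq b) := fun l =>
      {z | ¬(Hits e (i + c) (initSeg z l) ∨ B i (initSeg x l) (initSeg z l))}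
    have hKc : ∀ l, IsClosed (K l) := fun l =>
      (isClopen_initSeg l fun t => ¬(Hits e (i + c) t ∨ B i (initSeg x l) t)).isClosed
    have hKm : ∀ l l', l ≤ l' → K l' ⊆ K l := fun l l' hl z hz hz' =>
      hz (hz'.imp (Hits.mono hl) (hBm i x z l l' hl))
    have hKn : ∀ l, (K l).Nonempty := by
      intro l
      obtain ⟨t, ht, h⟩ := hcon (max m l) (hAm i x _ _ (le_max_left _ _) hm)
      refine ⟨extend t, hKm l _ (le_max_right m l) ?_⟩
      simp only [K, Set.mem_ofPred_eq]
      rw [← ht, initSeg_extend, ht]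
      tauto
    obtain ⟨z, hzK⟩ := IsCompact.nonempty_iInter_of_sequence_nonempty_isCompact_isClosed K
      (fun l => hKm l (l + 1) (Nat.le_succ l)) hKn (hKc 0).isCompact hKc
    rcases hz z with ⟨l, h⟩ | ⟨l, h⟩
    · exact Set.mem_iInter.1 hzK l (Or.inl h)
    · exact Set.mem_iInter.1 hzK l (Or.inr h)
  · rintro ⟨m, hm, h⟩
    refine ⟨⟨m, hm⟩, fun z => ?_⟩
    exact (h (initSeg z m) (by simp)).imp (fun h => ⟨m, h⟩) fun h => ⟨m, h⟩

/-! ### The length-lexicographic index -/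

theorem strIndex_append_singleton (σ : List (Fin 2)) (b : Fin 2) :
    strIndex (σ ++ [b]) = 2 * strIndex σ + 1 + b := by
  simp [strIndex, List.foldl_append]

theorem strIndex_nil : strIndex [] = 0 := rfl

theorem strIndex_eq_foldl (σ : List (Fin 2)) :
    strIndex σ = σ.foldl (fun (i : ℕ) (b : Fin 2) => 2 * i + 1 + b.val) 0 := by
  induction σ using List.reverseRecOn with
  | nil => rfl
  | append_singleton σ b ih =>
    rw [strIndex_append_singleton, ih]
    simp

theorem strIndex_injective : Function.Injective strIndex := by
  intro σ
  induction σ using List.reverseRecOn with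
  | nil =>
    intro τ h
    rcases List.eq_nil_or_concat' τ with rfl | ⟨τ, b, rfl⟩
    · rfl
    · rw [strIndex_append_singleton, strIndex_nil] at h
      omega
  | append_singleton σ a ih =>
    intro τ h
    rcases List.eq_nil_or_concat' τ with rfl | ⟨τ, b, rfl⟩
    · rw [strIndex_append_singleton, strIndex_nil] at h
      omega
    · rw [strIndex_append_singleton, strIndex_append_singleton] at h
      have ha := a.isLt
      have hb := b.isLt
      have h1 : (a : ℕ) = b := by omega
      have h2 : strIndex σ = strIndex τ := by omega
      rw [ih h2, Fin.ext h1]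

theorem strIndex_pos {σ : List (Fin 2)} (h : σ ≠ []) : 0 < strIndex σ := by
  rw [Nat.pos_iff_ne_zero]
  intro h0
  exact h (strIndex_injective (h0.trans (by rfl)))

/-- Nonemptiness is essential: by truncated subtraction the root would share the digit 0 with the
string `[0]`. -/
theorem strIndex_sub_one_inj {σ τ : List (Fin 2)} (hσ : σ ≠ []) (hτ : τ ≠ [])
    (h : strIndex σ - 1 = strIndex τ - 1) : σ = τ := by
  have := strIndex_pos hσ
  have := strIndex_pos hτ
  exact strIndex_injective (by omega)

/-- Labels of strings of length at most n lie among the first 2^(n+1) digits. This is the source of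
the powers of 2 in the later conditions on the length of initial segments. -/
theorem strIndex_add_two_le (σ : List (Fin 2)) : strIndex σ + 2 ≤ 2 ^ (σ.length + 1) := by
  induction σ using List.reverseRecOn with
  | nil => simp [strIndex]
  | append_singleton σ b ih =>
    have := b.isLt
    rw [strIndex_append_singleton, List.length_append, List.length_singleton, pow_succ]
    omega

theorem primrec_strIndex : Primrec strIndex := by
  have hv : Primrec fun b : Fin 2 => (b : ℕ) := Primrec.fin_val
  refine (Primrec.list_foldl (f := fun σ : List (Fin 2) => σ) (g := fun _ => 0)
    (h := fun _ p => 2 * p.1 + 1 + (p.2 : ℕ)) Primrec.id (Primrec.const 0) ?_).of_eq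
    fun σ => (strIndex_eq_foldl σ).symm
  exact Primrec.nat_add.comp (Primrec.succ.comp (Primrec.nat_mul.comp (Primrec.const 2)
    (Primrec.fst.comp Primrec.snd))) (hv.comp (Primrec.snd.comp Primrec.snd))

theorem label_congr {x y : Seq 3} {m : ℕ} (h : ∀ i < m, x i = y i) {σ : List (Fin 2)}
    (hσ : 2 ^ (σ.length + 1) ≤ m) : label x σ = label y σ := by
  have := strIndex_add_two_le σ
  exact h _ (by omega)

/-! ### Strings without the label `1`, and survival -/

/-- No nonempty initial segment of `σ` carries the label `1`. -/
def Good (x : Seq 3) (σ : List (Fin 2)) : Prop := ∀ j < σ.length, label x (σ.take (j + 1)) ≠ 1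

theorem good_nil (x : Seq 3) : Good x [] := by simp [Good]

theorem good_append_singleton {x : Seq 3} {σ : List (Fin 2)} {b : Fin 2} :
    Good x (σ ++ [b]) ↔ Good x σ ∧ label x (σ ++ [b]) ≠ 1 := by
  have hj : ∀ j < σ.length, (σ ++ [b]).take (j + 1) = σ.take (j + 1) := fun j hj =>
    List.take_append_of_le_length hj
  simp only [Good, List.length_append, List.length_singleton]
  constructor
  · refine fun h => ⟨fun j hjl => ?_, ?_⟩
    · rw [← hj j hjl]
      exact h j (by omega)
    · have := h σ.length (by omega)
      rwa [List.take_of_length_le (by simp)] at this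
  · rintro ⟨h, hb⟩ j hjl
    rcases Nat.lt_succ_iff_lt_or_eq.1 hjl with h1 | rfl
    · rw [hj j h1]
      exact h j h1
    · rwa [List.take_of_length_le (by simp)]

theorem good_congr {x y : Seq 3} {m : ℕ} (h : ∀ i < m, x i = y i) {σ : List (Fin 2)}
    (hσ : 2 ^ (σ.length + 1) ≤ m) : Good x σ ↔ Good y σ := by
  refine forall₂_congr fun j hj => ?_
  rw [label_congr h]
  refine le_trans (Nat.pow_le_pow_right (by norm_num) ?_) hσ
  simp

/-- Some string of length `k` can be appended to `σ` without meeting the label `1`. -/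
def AliveTo (x : Seq 3) : ℕ → List (Fin 2) → Prop
  | 0, _ => True
  | k + 1, σ => ∃ b : Fin 2, label x (σ ++ [b]) ≠ 1 ∧ AliveTo x k (σ ++ [b])

/-- Arbitrarily long strings can be appended to `σ` without meeting the label `1`. -/
def Alive (x : Seq 3) (σ : List (Fin 2)) : Prop := ∀ k, AliveTo x k σ

theorem AliveTo.pred {x : Seq 3} {k : ℕ} {σ : List (Fin 2)} (h : AliveTo x (k + 1) σ) :
    AliveTo x k σ := by
  induction k generalizing σ with
  | zero => trivial
  | succ k ih =>
    obtain ⟨b, hb, h⟩ := h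
    exact ⟨b, hb, ih h⟩

theorem AliveTo.anti {x : Seq 3} {k l : ℕ} (hkl : k ≤ l) {σ : List (Fin 2)} (h : AliveTo x l σ) :
    AliveTo x k σ := by
  induction l, hkl using Nat.le_induction with
  | base => exact h
  | succ l _ ih => exact ih h.pred

/-- König's lemma for two children: if each failed at some finite height, then σ would fail just
above the larger of the two. -/
theorem alive_iff {x : Seq 3} {σ : List (Fin 2)} :
    Alive x σ ↔ ∃ b : Fin 2, label x (σ ++ [b]) ≠ 1 ∧ Alive x (σ ++ [b]) := by
  constructor
  · intro h
    by_contra! hcon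
    simp only [Alive, not_forall] at hcon
    have hb : ∀ b : Fin 2, ∃ k, ¬(label x (σ ++ [b]) ≠ 1 ∧ AliveTo x k (σ ++ [b])) := by
      intro b
      by_cases hb : label x (σ ++ [b]) ≠ 1
      · obtain ⟨k, hk⟩ := hcon b hb
        exact ⟨k, fun h => hk h.2⟩
      · exact ⟨0, fun h => hb h.1⟩
    choose k hk using hb
    obtain ⟨b, hb, h'⟩ := h (max (k 0) (k 1) + 1)
    refine hk b ⟨hb, h'.anti ?_⟩
    fin_cases b <;> simp
  · rintro ⟨b, hb, h⟩ k
    exact AliveTo.pred ⟨b, hb, h k⟩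

/-- Rephrases recursive survival as a search through strings of one fixed length, the form in which
it enters `LevelRel` and the computability proofs. -/
theorem good_and_aliveTo_iff {x : Seq 3} {k : ℕ} {σ : List (Fin 2)} :
    Good x σ ∧ AliveTo x k σ ↔
      ∃ τ : List (Fin 2), τ.length = σ.length + k ∧ Good x τ ∧ τ.take σ.length = σ := by
  induction k generalizing σ with
  | zero =>
    constructor
    · exact fun h => ⟨σ, rfl, h.1, by simp⟩
    · rintro ⟨τ, h1, h2, h3⟩
      rw [List.take_of_length_le (by omega)] at h3
      exact ⟨h3 ▸ h2, trivial⟩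
  | succ k ih =>
    constructor
    · rintro ⟨hg, b, hb, h⟩
      obtain ⟨τ, h1, h2, h3⟩ := ih.1 ⟨good_append_singleton.2 ⟨hg, hb⟩, h⟩
      refine ⟨τ, ?_, h2, ?_⟩
      · rw [h1]
        simp
        omega
      · have := congrArg (List.take σ.length) h3
        simpa [List.take_take] using this
    · rintro ⟨τ, h1, h2, h3⟩
      have hlt : σ.length < τ.length := by omega
      have h4 : τ.take (σ.length + 1) = σ ++ [τ[σ.length]] := by
        rw [List.take_succ_eq_append_getElem hlt, h3]
      obtain ⟨hg, ha⟩ := (ih (σ := σ ++ [τ[σ.length]])).2 ⟨τ, by rw [List.length_append, List.length_singleton]; omega, h2,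
        by rwa [List.length_append, List.length_singleton]⟩
      rw [good_append_singleton] at hg
      exact ⟨hg.1, _, hg.2, ha⟩

/-! ### The breadth-first queue of a coded tree -/

theorem mem_children {d : Fin 3} {σ τ : List (Fin 2)} :
    τ ∈ children d σ ↔ ∃ b : Fin 2, τ = σ ++ [b] ∧ σ ++ [b] ∈ children d σ := by
  fin_cases d <;> simp [children]

theorem children_ne_nil (d : Fin 3) (σ : List (Fin 2)) : children d σ ≠ [] := by
  fin_cases d <;> simp [children]

theorem length_children_le (d : Fin 3) (σ : List (Fin 2)) : (children d σ).length ≤ 2 := by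
  fin_cases d <;> simp [children]

theorem children_injective {d e : Fin 3} {σ : List (Fin 2)}
    (h : ∀ b : Fin 2, σ ++ [b] ∈ children d σ ↔ σ ++ [b] ∈ children e σ) : d = e := by
  have h0 := h 0
  have h1 := h 1
  revert h0 h1
  fin_cases d <;> fin_cases e <;> simp [children]

/-- Remove the first node from a queue and append its children. -/
def queueStep (d : Fin 3) : List (List (Fin 2)) → List (List (Fin 2))
  | [] => []
  | σ :: Q => Q ++ children d σ

/-- The queue of a breadth-first traversal of the tree coded by `z` after `n` steps. -/
def queue (z : Seq 3) : ℕ → List (List (Fin 2))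
  | 0 => [[]]
  | n + 1 => queueStep (z n) (queue z n)

/-- The node of the coded tree that uses the digit `z n`. -/
def node (z : Seq 3) (n : ℕ) : List (Fin 2) := (queue z n).headI

theorem queue_ne_nil (z : Seq 3) (n : ℕ) : queue z n ≠ [] := by
  induction n with
  | zero => simp [queue]
  | succ n ih =>
    obtain ⟨σ, Q, h⟩ := List.exists_cons_of_ne_nil ih
    simp [queue, h, queueStep, children_ne_nil]

theorem queue_eq_cons (z : Seq 3) (n : ℕ) : queue z n = node z n :: (queue z n).tail := by
  obtain ⟨σ, Q, h⟩ := List.exists_cons_of_ne_nil (queue_ne_nil z n)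
  simp [node, h]

theorem queue_succ (z : Seq 3) (n : ℕ) :
    queue z (n + 1) = (queue z n).tail ++ children (z n) (node z n) := by
  rw [queue, queue_eq_cons z n]
  rfl

theorem node_mem_queue (z : Seq 3) (n : ℕ) : node z n ∈ queue z n := by
  rw [queue_eq_cons]
  simp

theorem queue_congr {z w : Seq 3} {n : ℕ} (h : ∀ i < n, z i = w i) : queue z n = queue w n := by
  induction n with
  | zero => rfl
  | succ n ih => rw [queue, queue, ih fun i hi => h i (by omega), h n (by omega)]

/-- Processes a block A at the front of the queue in one go. With A a whole level and B empty, this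
matches the level-by-level definition of the tree with the digit-by-digit one. -/
theorem queue_add (z : Seq 3) (A : List (List (Fin 2))) (B : List (List (Fin 2))) (n : ℕ)
    (h : queue z n = A ++ B) : queue z (n + A.length) =
      B ++ (A.zipIdx n).flatMap fun p => children (z p.2) p.1 := by
  induction A generalizing B n with
  | nil => simpa using h
  | cons σ A ih =>
    have h1 : queue z (n + 1) = A ++ (B ++ children (z n) σ) := by
      rw [queue, h]
      simp [queueStep]
    have := ih _ _ h1
    rw [List.length_cons, show n + (A.length + 1) = n + 1 + A.length by omega, this]
    simp [List.zipIdx_cons]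

theorem queue_treeLevel (z : Seq 3) (k : ℕ) :
    queue z (treeLevel z k).2 = (treeLevel z k).1 := by
  induction k with
  | zero => rfl
  | succ k ih =>
    have := queue_add z (treeLevel z k).1 [] _ (by simpa using ih)
    simpa [treeLevel] using this

theorem node_of_mem_zipIdx {z : Seq 3} {k i : ℕ} {σ : List (Fin 2)}
    (h : (σ, i) ∈ (treeLevel z k).1.zipIdx (treeLevel z k).2) : node z i = σ := by
  rw [List.mk_mem_zipIdx_iff_le_and_getElem?_sub] at h
  obtain ⟨hle, h⟩ := h
  obtain ⟨hlt, h⟩ := List.getElem?_eq_some_iff.1 h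
  have := queue_add z ((treeLevel z k).1.take (i - (treeLevel z k).2))
    ((treeLevel z k).1.drop (i - (treeLevel z k).2)) (treeLevel z k).2
    (by rw [List.take_append_drop, queue_treeLevel])
  rw [List.length_take, min_eq_left hlt.le, Nat.add_sub_cancel' hle,
    List.drop_eq_getElem_cons hlt, h] at this
  simp [node, this]

theorem mem_treeLevel_succ {z : Seq 3} {k : ℕ} {τ : List (Fin 2)} :
    τ ∈ (treeLevel z (k + 1)).1 ↔
      ∃ i, (node z i, i) ∈ (treeLevel z k).1.zipIdx (treeLevel z k).2 ∧
        τ ∈ children (z i) (node z i) := by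
  simp only [treeLevel, List.mem_flatMap, Prod.exists]
  constructor
  · rintro ⟨σ, i, h, hτ⟩
    obtain rfl := node_of_mem_zipIdx h
    exact ⟨i, h, hτ⟩
  · rintro ⟨i, h, hτ⟩
    exact ⟨_, i, h, hτ⟩

theorem exists_node_of_mem_treeLevel {z : Seq 3} {k : ℕ} {σ : List (Fin 2)}
    (h : σ ∈ (treeLevel z k).1) :
    ∃ i, node z i = σ ∧ (node z i, i) ∈ (treeLevel z k).1.zipIdx (treeLevel z k).2 := by
  obtain ⟨j, hj, h⟩ := List.getElem_of_mem h
  have hm : (σ, (treeLevel z k).2 + j) ∈ (treeLevel z k).1.zipIdx (treeLevel z k).2 := by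
    rw [List.mk_mem_zipIdx_iff_le_and_getElem?_sub]
    exact ⟨by omega, by simp [hj, h]⟩
  obtain rfl := node_of_mem_zipIdx hm
  exact ⟨_, rfl, hm⟩

theorem treeLevel_ne_nil (z : Seq 3) (k : ℕ) : (treeLevel z k).1 ≠ [] := by
  rw [← queue_treeLevel]
  exact queue_ne_nil _ _

theorem exists_mem_treeLevel_zipIdx (z : Seq 3) (i : ℕ) :
    ∃ k, (node z i, i) ∈ (treeLevel z k).1.zipIdx (treeLevel z k).2 := by
  have hgrow : ∀ k, k ≤ (treeLevel z k).2 := by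
    intro k
    induction k with
    | zero => simp
    | succ k ih =>
      have := List.length_pos_iff.2 (treeLevel_ne_nil z k)
      simp only [treeLevel]
      omega
  have hex : ∃ k, i < (treeLevel z k).2 := ⟨i + 1, hgrow (i + 1)⟩
  classical
  -- The first level whose count of earlier nodes exceeds i is not level 0, where that count is 0;
  -- the level just before it contains node i.
  obtain ⟨k, hk⟩ : ∃ k, Nat.find hex = k + 1 := by
    refine Nat.exists_eq_succ_of_ne_zero fun h0 => ?_
    have := Nat.find_spec hex
    rw [h0] at this
    simp [treeLevel] at this
  have h1 := Nat.find_spec hex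
  have h2 := Nat.find_min hex (m := k) (by omega)
  rw [hk] at h1
  simp only [treeLevel] at h1
  push Not at h2
  have hlt : i - (treeLevel z k).2 < (treeLevel z k).1.length := by omega
  have hm : ((treeLevel z k).1[i - (treeLevel z k).2], i) ∈
      (treeLevel z k).1.zipIdx (treeLevel z k).2 := by
    rw [List.mk_mem_zipIdx_iff_le_and_getElem?_sub]
    exact ⟨h2, by simp [hlt]⟩
  refine ⟨k, ?_⟩
  rwa [← node_of_mem_zipIdx hm] at hm

theorem length_of_mem_treeLevel {z : Seq 3} {k : ℕ} {σ : List (Fin 2)}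
    (h : σ ∈ (treeLevel z k).1) : σ.length = k := by
  induction k generalizing σ with
  | zero => simpa [treeLevel] using h
  | succ k ih =>
    obtain ⟨i, hi, hσ⟩ := mem_treeLevel_succ.1 h
    obtain ⟨b, rfl, -⟩ := mem_children.1 hσ
    simp [ih (List.fst_mem_of_mem_zipIdx hi)]

theorem mem_codedTree_iff {z : Seq 3} {k : ℕ} {σ : List (Fin 2)} (h : σ.length = k) :
    σ ∈ codedTree z ↔ σ ∈ (treeLevel z k).1 := by
  subst h
  rfl

/-! ### Incomparability of the nodes in the queue -/

/-- Neither string is an initial segment of the other. -/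
def Incomp (σ τ : List (Fin 2)) : Prop := ¬σ <+: τ ∧ ¬τ <+: σ

theorem Incomp.symm {σ τ : List (Fin 2)} (h : Incomp σ τ) : Incomp τ σ := ⟨h.2, h.1⟩

theorem Incomp.append_left {σ τ : List (Fin 2)} (h : Incomp σ τ) (ρ : List (Fin 2)) :
    Incomp (σ ++ ρ) τ := by
  refine ⟨fun h1 => h.1 ((List.prefix_append σ ρ).trans h1), fun h1 => ?_⟩
  rcases List.prefix_or_prefix_of_prefix h1 (List.prefix_append σ ρ) with h2 | h2
  · exact h.2 h2
  · exact h.1 h2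

theorem incomp_append_singleton (σ : List (Fin 2)) {a b : Fin 2} (h : a ≠ b) :
    Incomp (σ ++ [a]) (σ ++ [b]) := by
  simp [Incomp, List.prefix_append_right_inj, h, h.symm]

theorem pairwise_incomp_queueStep {d : Fin 3} {σ : List (Fin 2)} {Q : List (List (Fin 2))}
    (h : (σ :: Q).Pairwise Incomp) : (Q ++ children d σ).Pairwise Incomp := by
  rw [List.pairwise_cons] at h
  rw [List.pairwise_append]
  refine ⟨h.2, ?_, fun τ hτ ρ hρ => ?_⟩
  · have := incomp_append_singleton σ (a := 0) (b := 1) (by decide)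
    fin_cases d <;> simp [children, this]
  · obtain ⟨b, rfl, -⟩ := mem_children.1 hρ
    exact ((h.1 τ hτ).append_left [b]).symm

/-- The pending nodes form an antichain, so their subtrees use disjoint sets of digits. This is what
makes their survivals independent. -/
theorem pairwise_incomp_queue (z : Seq 3) (n : ℕ) : (queue z n).Pairwise Incomp := by
  induction n with
  | zero => simp [queue]
  | succ n ih =>
    rw [queue_eq_cons] at ih
    rw [queue_succ]
    exact pairwise_incomp_queueStep ih

theorem nodup_treeLevel (z : Seq 3) (k : ℕ) : (treeLevel z k).1.Nodup := by
  rw [← queue_treeLevel]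
  exact (pairwise_incomp_queue z _).imp fun h => by
    rintro rfl
    exact h.1 List.prefix_rfl

theorem append_singleton_mem_treeLevel_succ {z : Seq 3} {k i : ℕ}
    (h : (node z i, i) ∈ (treeLevel z k).1.zipIdx (treeLevel z k).2) (b : Fin 2) :
    node z i ++ [b] ∈ (treeLevel z (k + 1)).1 ↔ node z i ++ [b] ∈ children (z i) (node z i) := by
  rw [mem_treeLevel_succ]
  refine ⟨?_, fun hb => ⟨i, h, hb⟩⟩
  rintro ⟨j, hj, hb⟩
  obtain ⟨c, hc, -⟩ := mem_children.1 hb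
  have hn := List.append_inj_left' hc rfl
  have : i = j := by
    rw [List.mk_mem_zipIdx_iff_le_and_getElem?_sub] at h hj
    have hn' := nodup_treeLevel z k
    rw [← hn] at hj
    obtain ⟨h1, h1'⟩ := List.getElem?_eq_some_iff.1 h.2
    obtain ⟨h2, h2'⟩ := List.getElem?_eq_some_iff.1 hj.2
    have := (hn'.getElem_inj_iff (hi := h1) (hj := h2)).1 (h1'.trans h2'.symm)
    omega
  rwa [this] at hb ⊢

/-! ### The code of the tree of surviving nodes -/

/-- The digit `d` describes which children of `σ` have a label other than `1` and survive. -/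
def Pattern (x : Seq 3) (σ : List (Fin 2)) (d : Fin 3) : Prop :=
  ∀ b : Fin 2, (label x (σ ++ [b]) ≠ 1 ∧ Alive x (σ ++ [b])) ↔ σ ++ [b] ∈ children d σ

theorem Pattern.unique {x : Seq 3} {σ : List (Fin 2)} {d e : Fin 3} (hd : Pattern x σ d)
    (he : Pattern x σ e) : d = e :=
  children_injective fun b => (hd b).symm.trans (he b)

theorem exists_pattern {x : Seq 3} {σ : List (Fin 2)} (h : Alive x σ) : ∃ d, Pattern x σ d := by
  rw [alive_iff, Fin.exists_fin_two] at h
  by_cases h0 : label x (σ ++ [0]) ≠ 1 ∧ Alive x (σ ++ [0])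
  · by_cases h1 : label x (σ ++ [1]) ≠ 1 ∧ Alive x (σ ++ [1])
    · exact ⟨2, fun b => by fin_cases b <;> simp [children, h0, h1]⟩
    · refine ⟨0, fun b => ?_⟩
      fin_cases b
      · simp [children, h0]
      · simpa [children] using h1
  · have h1 := h.resolve_left h0
    refine ⟨1, fun b => ?_⟩
    fin_cases b
    · simpa [children] using h0
    · simp [children, h1]

theorem Pattern.alive_child {x : Seq 3} {σ τ : List (Fin 2)} {d : Fin 3} (h : Pattern x σ d)
    (hτ : τ ∈ children d σ) : Alive x τ := by
  obtain ⟨b, rfl, hb⟩ := mem_children.1 hτ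
  exact ((h b).2 hb).2

theorem Pattern.alive {x : Seq 3} {σ : List (Fin 2)} {d : Fin 3} (h : Pattern x σ d) :
    Alive x σ := by
  obtain ⟨τ, hτ⟩ := List.exists_mem_of_ne_nil _ (children_ne_nil d σ)
  obtain ⟨b, rfl, hb⟩ := mem_children.1 hτ
  exact alive_iff.2 ⟨b, (h b).2 hb⟩

/-- The first `n` digits of `z` code the tree of surviving nodes. -/
def CodesTo (x z : Seq 3) (n : ℕ) : Prop :=
  Alive x [] ∧ ∀ i < n, Pattern x (node z i) (z i)

/-- The sequence `z` codes the tree of surviving nodes. -/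
def Codes (x z : Seq 3) : Prop := ∀ i, Pattern x (node z i) (z i)

theorem Codes.alive {x z : Seq 3} (h : Codes x z) : Alive x [] := (h 0).alive

/-- Earlier digits determine the current node, and its surviving children determine the digit. -/
theorem CodesTo.agree {x z w : Seq 3} {n : ℕ} (hz : CodesTo x z n) (hw : CodesTo x w n) :
    ∀ i < n, z i = w i := by
  intro i
  induction i using Nat.strong_induction_on with
  | _ i ih =>
    intro hi
    have hq : node z i = node w i := by
      rw [node, node, queue_congr fun j hj => ih j hj (hj.trans hi)]
    have h1 := hz.2 i hi
    rw [hq] at h1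
    exact h1.unique (hw.2 i hi)

theorem CodesTo.congr {x z w : Seq 3} {n : ℕ} (h : ∀ i < n, z i = w i) (hz : CodesTo x z n) :
    CodesTo x w n := by
  refine ⟨hz.1, fun i hi => ?_⟩
  have := hz.2 i hi
  rwa [node, queue_congr fun j hj => h j (hj.trans hi), h i hi] at this

theorem Codes.unique {x z w : Seq 3} (hz : Codes x z) (hw : Codes x w) : z = w :=
  funext fun i => CodesTo.agree (n := i + 1) ⟨hz.alive, fun j _ => hz j⟩ ⟨hz.alive, fun j _ => hw j⟩
    i (Nat.lt_succ_self i)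

open Classical in
/-- The digit that describes the surviving children of `σ`, if there are any. -/
noncomputable def patternDigit (x : Seq 3) (σ : List (Fin 2)) : Fin 3 :=
  if h : ∃ d, Pattern x σ d then h.choose else 0

theorem pattern_patternDigit {x : Seq 3} {σ : List (Fin 2)} (h : Alive x σ) :
    Pattern x σ (patternDigit x σ) := by
  have h' := exists_pattern h
  rw [patternDigit, dif_pos h']
  exact h'.choose_spec

/-- The queue of the breadth-first traversal of the tree of surviving nodes. -/
noncomputable def aliveQueue (x : Seq 3) : ℕ → List (List (Fin 2))
  | 0 => [[]]
  | n + 1 => queueStep (patternDigit x (aliveQueue x n).headI) (aliveQueue x n)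

open Classical in
/-- The code of the tree of surviving nodes, if there are any. -/
noncomputable def aliveCode (x : Seq 3) : Seq 3 :=
  if Alive x [] then fun n => patternDigit x (aliveQueue x n).headI else 0

theorem codes_aliveCode {x : Seq 3} (h : Alive x []) : Codes x (aliveCode x) := by
  rw [aliveCode, if_pos h]
  set z : Seq 3 := fun n => patternDigit x (aliveQueue x n).headI with hz
  have hqueue : ∀ n, queue z n = aliveQueue x n := by
    intro n
    induction n with
    | zero => rfl
    | succ n ih => rw [queue, ih, aliveQueue]
  have hdigit : ∀ n, z n = patternDigit x (node z n) := by
    intro n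
    rw [node, hqueue]
  -- Only surviving nodes are ever queued, so the default value of `patternDigit` is never used.
  have hq : ∀ n, ∀ σ ∈ queue z n, Alive x σ := by
    intro n
    induction n with
    | zero => simpa [queue] using h
    | succ n ih =>
      intro σ hσ
      rw [queue_succ, List.mem_append] at hσ
      rcases hσ with hσ | hσ
      · exact ih σ (List.mem_of_mem_tail hσ)
      · rw [hdigit] at hσ
        exact (pattern_patternDigit (ih _ (node_mem_queue _ n))).alive_child hσ
  intro n
  rw [hdigit]
  exact pattern_patternDigit (hq n _ (node_mem_queue _ n))

theorem codesTo_iff {x z : Seq 3} {n : ℕ} :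
    CodesTo x z n ↔ Alive x [] ∧ initSeg (aliveCode x) n = initSeg z n := by
  rw [initSeg_eq_initSeg]
  constructor
  · intro h
    exact ⟨h.1, CodesTo.agree ⟨h.1, fun i _ => codes_aliveCode h.1 i⟩ h⟩
  · rintro ⟨h, hz⟩
    exact CodesTo.congr hz ⟨h, fun i _ => codes_aliveCode h i⟩

theorem Codes.mem_codedTree {x z : Seq 3} (h : Codes x z) (σ : List (Fin 2)) :
    σ ∈ codedTree z ↔ Good x σ ∧ Alive x σ := by
  induction σ using List.reverseRecOn with
  | nil => simp [codedTree, treeLevel, good_nil, h.alive]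
  | append_singleton σ b ih =>
    rw [mem_codedTree_iff (k := σ.length + 1) (by simp), good_append_singleton]
    rw [mem_codedTree_iff rfl] at ih
    constructor
    · intro hσ
      obtain ⟨i, hi, hσ⟩ := mem_treeLevel_succ.1 hσ
      obtain ⟨c, hc, hm⟩ := mem_children.1 hσ
      obtain ⟨hn, hbc⟩ := List.append_inj' hc rfl
      rw [← hn] at hi hσ
      obtain ⟨hg, -⟩ := ih.1 (List.fst_mem_of_mem_zipIdx hi)
      have hp := (h i b).2 (by rwa [← hn])
      rw [← hn] at hp
      exact ⟨⟨hg, hp.1⟩, hp.2⟩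
    · rintro ⟨⟨hg, hl⟩, ha⟩
      obtain ⟨i, rfl, hi⟩ := exists_node_of_mem_treeLevel (ih.2 ⟨hg, alive_iff.2 ⟨b, hl, ha⟩⟩)
      exact (append_singleton_mem_treeLevel_succ hi b).2 ((h i b).1 ⟨hl, ha⟩)

/-! ### The effectively closed relation between `x` and the code of its surviving nodes -/

/-- The `n`-th level of the tree coded by `z` consists of strings without the label `1`, and
contains all those that can be extended by `k` more symbols. -/
def LevelRel (x z : Seq 3) (n k : ℕ) : Prop :=
  (∀ σ ∈ (treeLevel z n).1, Good x σ) ∧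
    ∀ τ ∈ allStrings 2 (n + k), Good x τ → τ.take n ∈ (treeLevel z n).1

/-- How far above the `n`-th level one has to look so that mistakes have probability `2^(-i)`. -/
def lookahead (i n : ℕ) : ℕ := 2 * (2 * n + i)

/-- An effectively closed approximation to the relation `Codes`. -/
def CodesRel (i : ℕ) (x z : Seq 3) : Prop := ∀ n, LevelRel x z n (lookahead i n)

/-- Every string that survives for `lookahead i` levels survives forever. -/
def Reliable (i : ℕ) (x : Seq 3) : Prop :=
  ∀ σ : List (Fin 2), AliveTo x (lookahead i σ.length) σ → Alive x σ

/-- A coded tree has no dead ends, so if all its nodes are `Good` then all of them survive; the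
second half of `LevelRel` forces every surviving node into it. Hence the finite lookahead causes no
error in this direction, whatever i and x are. -/
theorem CodesRel.mem_codedTree {i : ℕ} {x z : Seq 3} (h : CodesRel i x z) (σ : List (Fin 2)) :
    σ ∈ codedTree z ↔ Good x σ ∧ Alive x σ := by
  constructor
  · intro hσ
    refine ⟨(h _).1 σ hσ, fun k => ?_⟩
    induction k generalizing σ with
    | zero => trivial
    | succ k ih =>
      obtain ⟨j, rfl, hj⟩ := exists_node_of_mem_treeLevel (show σ ∈ (treeLevel z σ.length).1 from hσ)
      obtain ⟨τ, hτ⟩ := List.exists_mem_of_ne_nil _ (children_ne_nil (z j) (node z j))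
      obtain ⟨b, rfl, hb⟩ := mem_children.1 hτ
      have hm := (append_singleton_mem_treeLevel_succ hj b).2 hb
      refine ⟨b, (good_append_singleton.1 ((h _).1 _ hm)).2, ih _ ?_⟩
      rwa [mem_codedTree_iff (k := (node z j).length + 1) (by simp)]
  · rintro ⟨hg, ha⟩
    obtain ⟨τ, h1, h2, h3⟩ := good_and_aliveTo_iff.1 ⟨hg, ha (lookahead i σ.length)⟩
    have := (h σ.length).2 τ (mem_allStrings.2 h1) h2
    rwa [h3] at this

theorem CodesRel.codes {i : ℕ} {x z : Seq 3} (h : CodesRel i x z) : Codes x z := by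
  intro j b
  obtain ⟨k, hk⟩ := exists_mem_treeLevel_zipIdx z j
  have hl : (node z j).length = k := length_of_mem_treeLevel (List.fst_mem_of_mem_zipIdx hk)
  have hg := ((h.mem_codedTree _).1 ((mem_codedTree_iff hl).2 (List.fst_mem_of_mem_zipIdx hk))).1
  rw [← append_singleton_mem_treeLevel_succ hk b, ← mem_codedTree_iff (by simp [hl]),
    h.mem_codedTree, good_append_singleton]
  tauto

/-- Only here does reliability enter: `LevelRel` demands every node that survives for the lookahead,
while the coded tree contains only those that survive forever. -/
theorem Codes.codesRel {i : ℕ} {x z : Seq 3} (h : Codes x z) (hx : Reliable i x) :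
    CodesRel i x z := by
  refine fun n => ⟨fun σ hσ => ?_, fun τ hτ hg => ?_⟩
  · rw [← mem_codedTree_iff (length_of_mem_treeLevel hσ)] at hσ
    exact ((h.mem_codedTree σ).1 hσ).1
  · rw [mem_allStrings] at hτ
    have hl : (τ.take n).length = n := by simp; omega
    rw [← mem_codedTree_iff hl, h.mem_codedTree]
    have := (good_and_aliveTo_iff (σ := τ.take n) (k := lookahead i n)).2
      ⟨τ, by rw [hl, hτ], hg, by rw [hl]⟩
    exact ⟨this.1, hx _ (by rw [hl]; exact this.2)⟩

/-! ### Computability of the relation -/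

theorem treeLevel_bound (z : Seq 3) (n : ℕ) :
    (treeLevel z n).1.length ≤ 2 ^ n ∧ (treeLevel z n).2 + 1 ≤ 2 ^ n := by
  induction n with
  | zero => simp [treeLevel]
  | succ n ih =>
    refine ⟨?_, ?_⟩
    · simp only [treeLevel, List.length_flatMap]
      refine (List.sum_le_card_nsmul _ 2 ?_).trans ?_
      · simp only [List.mem_map]
        rintro _ ⟨p, -, rfl⟩
        exact length_children_le _ _
      · rw [List.length_map, List.length_zipIdx, smul_eq_mul, pow_succ]
        omega
    · simp only [treeLevel, pow_succ]
      omega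

theorem treeLevel_congr {z w : Seq 3} {n : ℕ} (h : ∀ i < 2 ^ n, z i = w i) :
    treeLevel z n = treeLevel w n := by
  induction n with
  | zero => rfl
  | succ n ih =>
    have := ih fun i hi => h i (hi.trans_le (Nat.pow_le_pow_right (by norm_num) (Nat.le_succ n)))
    simp only [treeLevel, this, Prod.mk.injEq, and_true]
    refine List.flatMap_congr fun p hp => ?_
    have hb := treeLevel_bound w n
    have := List.snd_lt_of_mem_zipIdx hp
    rw [h]
    rw [pow_succ]
    omega

theorem levelRel_congr {x y z w : Seq 3} {n k m : ℕ} (hm : 2 ^ (n + k + 1) ≤ m)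
    (hx : ∀ i < m, x i = y i) (hz : ∀ i < m, z i = w i) :
    LevelRel x z n k ↔ LevelRel y w n k := by
  have hpow : 2 ^ n ≤ m := (Nat.pow_le_pow_right (by norm_num) (by omega)).trans hm
  have hpow' : 2 ^ (n + 1) ≤ m := (Nat.pow_le_pow_right (by norm_num) (by omega)).trans hm
  rw [LevelRel, LevelRel, treeLevel_congr fun i hi => hz i (hi.trans_le hpow)]
  refine and_congr (forall₂_congr fun σ hσ => good_congr hx ?_)
    (forall₂_congr fun τ hτ => imp_congr_left (good_congr hx ?_))
  · rwa [length_of_mem_treeLevel hσ]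
  · rwa [mem_allStrings.1 hτ]

/-- The initial segments `s` and `t` of `x` and `z` show that `CodesRel i x z` fails. -/
def Refutes (i : ℕ) (s t : List (Fin 3)) : Prop :=
  ∃ n < s.length, 2 ^ (n + lookahead i n + 1) ≤ s.length ∧
    ¬LevelRel (extend s) (extend t) n (lookahead i n)

/-- Each level condition depends on finitely many digits, so `CodesRel i` is effectively closed: its
failure is seen on initial segments. -/
theorem codesRel_iff {i : ℕ} {x z : Seq 3} :
    CodesRel i x z ↔ ∀ m, ¬Refutes i (initSeg x m) (initSeg z m) := by
  constructor
  · rintro h m ⟨n, -, hm, hn⟩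
    rw [length_initSeg] at hm
    exact hn ((levelRel_congr hm (fun i hi => extend_initSeg x hi)
      fun i hi => extend_initSeg z hi).2 (h n))
  · intro h n
    by_contra hn
    refine h (2 ^ (n + lookahead i n + 1)) ⟨n, ?_, by simp, ?_⟩
    · rw [length_initSeg]
      exact lt_of_lt_of_le Nat.lt_two_pow_self (Nat.pow_le_pow_right (by norm_num) (by omega))
    · rwa [levelRel_congr le_rfl (fun i hi => extend_initSeg x hi) fun i hi => extend_initSeg z hi]

theorem Refutes.mono {i : ℕ} {x z : Seq 3} {m l : ℕ} (hml : m ≤ l)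
    (h : Refutes i (initSeg x m) (initSeg z m)) : Refutes i (initSeg x l) (initSeg z l) := by
  obtain ⟨n, hn, hm, h⟩ := h
  rw [length_initSeg] at hn hm
  refine ⟨n, by simp; omega, by simp; omega, ?_⟩
  rwa [levelRel_congr hm (y := extend (initSeg x m)) (w := extend (initSeg z m))]
  · intro j hj
    rw [extend_initSeg x hj, extend_initSeg x (by omega)]
  · intro j hj
    rw [extend_initSeg z hj, extend_initSeg z (by omega)]

theorem primrec_extend {n : ℕ} [NeZero n] :
    Primrec₂ fun (s : List (Fin n)) (i : ℕ) => extend s i :=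
  Primrec.list_getD 0

theorem primrec_label : Primrec₂ fun (s : List (Fin 3)) (σ : List (Fin 2)) => label (extend s) σ :=
  primrec_extend.comp Primrec.fst
    (Primrec.nat_sub.comp (primrec_strIndex.comp Primrec.snd) (Primrec.const 1))

theorem primrecPred_good :
    PrimrecPred fun p : List (Fin 3) × List (Fin 2) => Good (extend p.1) p.2 := by
  refine primrecPred_forall_lt (f := fun p : List (Fin 3) × List (Fin 2) => p.2.length)
    (p := fun p j => label (extend p.1) (p.2.take (j + 1)) ≠ 1)
    (Primrec.list_length.comp Primrec.snd) ?_
  exact (Primrec.eq.comp (primrec_label.comp (Primrec.fst.comp Primrec.fst)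
    (Primrec.list_take.comp (Primrec.succ.comp Primrec.snd) (Primrec.snd.comp Primrec.fst)))
    (Primrec.const 1)).not

theorem primrec_children : Primrec₂ children := by
  have h0 : Primrec fun p : Fin 3 × List (Fin 2) => [p.2 ++ [(0 : Fin 2)]] :=
    Primrec.list_cons.comp (Primrec.list_concat.comp Primrec.snd (Primrec.const 0))
      (Primrec.const [])
  have h1 : Primrec fun p : Fin 3 × List (Fin 2) => [p.2 ++ [(1 : Fin 2)]] :=
    Primrec.list_cons.comp (Primrec.list_concat.comp Primrec.snd (Primrec.const 1))
      (Primrec.const [])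
  have h : Primrec fun p : Fin 3 × List (Fin 2) =>
      if p.1 = 0 then [p.2 ++ [(0 : Fin 2)]] else if p.1 = 1 then [p.2 ++ [(1 : Fin 2)]]
        else [p.2 ++ [(0 : Fin 2)]] ++ [p.2 ++ [(1 : Fin 2)]] :=
    Primrec.ite (Primrec.eq.comp Primrec.fst (Primrec.const 0)) h0
      (Primrec.ite (Primrec.eq.comp Primrec.fst (Primrec.const 1)) h1
        (Primrec.list_append.comp h0 h1))
  refine h.of_eq ?_
  rintro ⟨d, σ⟩
  fin_cases d <;> simp [children]

/-- Brings the definition of `treeLevel` into a form built from primitive recursive list operations.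
-/
theorem zipIdx_eq_map_range {α : Type*} (L : List α) (c : ℕ) (a : α) :
    L.zipIdx c = (List.range L.length).map fun j => (L.getD j a, c + j) := by
  refine List.ext_getElem (by simp) fun i h1 h2 => ?_
  have : i < L.length := by simpa using h1
  simp [this]

theorem primrec_treeLevel :
    Primrec₂ fun (t : List (Fin 3)) (n : ℕ) => treeLevel (extend t) n := by
  have h : Primrec₂ fun (t : List (Fin 3)) (n : ℕ) =>
      Nat.rec (motive := fun _ => List (List (Fin 2)) × ℕ) ([[]], 0)
        (fun _ p => ((List.range p.1.length).flatMap fun j =>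
          children (extend t (p.2 + j)) (p.1.getD j []), p.2 + p.1.length)) n := by
    refine Primrec.nat_rec (f := fun _ : List (Fin 3) => (([[]], 0) : List (List (Fin 2)) × ℕ))
      (g := fun t q => ((List.range q.2.1.length).flatMap fun j =>
          children (extend t (q.2.2 + j)) (q.2.1.getD j []), q.2.2 + q.2.1.length))
      (Primrec.const _) ?_
    have hL : Primrec fun a : List (Fin 3) × ℕ × List (List (Fin 2)) × ℕ => a.2.2.1 :=
      Primrec.fst.comp (Primrec.snd.comp Primrec.snd)
    have hc : Primrec fun a : List (Fin 3) × ℕ × List (List (Fin 2)) × ℕ => a.2.2.2 :=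
      Primrec.snd.comp (Primrec.snd.comp Primrec.snd)
    refine Primrec.pair (Primrec.list_flatMap (Primrec.list_range.comp
      (Primrec.list_length.comp hL)) ?_) (Primrec.nat_add.comp hc (Primrec.list_length.comp hL))
    exact primrec_children.comp (primrec_extend.comp (Primrec.fst.comp Primrec.fst)
      (Primrec.nat_add.comp (hc.comp Primrec.fst) Primrec.snd))
      ((Primrec.list_getD []).comp (hL.comp Primrec.fst) Primrec.snd)
  refine h.of_eq fun t n => ?_
  induction n with
  | zero => rfl
  | succ n ih =>
    simp only [ih, treeLevel]
    rw [zipIdx_eq_map_range _ _ [], List.flatMap_map]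

theorem primrecPred_mem {α β : Type*} [Primcodable α] [Primcodable β] {f : α → List β}
    {g : α → β} (hf : Primrec f) (hg : Primrec g) : PrimrecPred fun a => g a ∈ f a := by
  classical
  refine (primrecPred_exists_mem (p := fun a b => b = g a) hf
    (Primrec.eq.comp Primrec.snd (hg.comp Primrec.fst))).of_eq fun a => ?_
  simp

theorem primrecPred_levelRel :
    PrimrecPred fun p : (List (Fin 3) × List (Fin 3)) × ℕ × ℕ =>
      LevelRel (extend p.1.1) (extend p.1.2) p.2.1 p.2.2 := by
  have hs : Primrec fun p : (List (Fin 3) × List (Fin 3)) × ℕ × ℕ => p.1.1 :=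
    Primrec.fst.comp Primrec.fst
  have hn : Primrec fun p : (List (Fin 3) × List (Fin 3)) × ℕ × ℕ => p.2.1 :=
    Primrec.fst.comp Primrec.snd
  have hT : Primrec fun p : (List (Fin 3) × List (Fin 3)) × ℕ × ℕ =>
      (treeLevel (extend p.1.2) p.2.1).1 :=
    Primrec.fst.comp (primrec_treeLevel.comp (Primrec.snd.comp Primrec.fst) hn)
  refine (primrecPred_forall_mem
    (p := fun (p : (List (Fin 3) × List (Fin 3)) × ℕ × ℕ) σ => Good (extend p.1.1) σ) hT
      (primrecPred_good.comp ((hs.comp Primrec.fst).pair Primrec.snd))).and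
    (primrecPred_forall_mem
      (f := fun p : (List (Fin 3) × List (Fin 3)) × ℕ × ℕ => allStrings 2 (p.2.1 + p.2.2))
      (p := fun (p : (List (Fin 3) × List (Fin 3)) × ℕ × ℕ) τ =>
        Good (extend p.1.1) τ → τ.take p.2.1 ∈ (treeLevel (extend p.1.2) p.2.1).1)
      ((primrec_allStrings 2).comp (Primrec.nat_add.comp hn (Primrec.snd.comp Primrec.snd)))
      (primrecPred_imp (primrecPred_good.comp ((hs.comp Primrec.fst).pair Primrec.snd))
        (primrecPred_mem (hT.comp Primrec.fst)
          (Primrec.list_take.comp (hn.comp Primrec.fst) Primrec.snd))))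

theorem primrec_lookahead : Primrec₂ lookahead :=
  Primrec.nat_mul.comp (Primrec.const 2) (Primrec.nat_add.comp
    (Primrec.nat_mul.comp (Primrec.const 2) Primrec.snd) Primrec.fst)

theorem primrecPred_refutes :
    PrimrecPred fun p : ℕ × List (Fin 3) × List (Fin 3) => Refutes p.1 p.2.1 p.2.2 := by
  refine primrecPred_exists_lt (f := fun p : ℕ × List (Fin 3) × List (Fin 3) => p.2.1.length)
    (p := fun p n => 2 ^ (n + lookahead p.1 n + 1) ≤ p.2.1.length ∧
      ¬LevelRel (extend p.2.1) (extend p.2.2) n (lookahead p.1 n))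
    (Primrec.list_length.comp (Primrec.fst.comp Primrec.snd)) ?_
  have hl : Primrec fun q : (ℕ × List (Fin 3) × List (Fin 3)) × ℕ => lookahead q.1.1 q.2 :=
    primrec_lookahead.comp (Primrec.fst.comp Primrec.fst) Primrec.snd
  refine (Primrec.nat_le.comp (primrec_pow.comp (Primrec.const 2)
    (Primrec.succ.comp (Primrec.nat_add.comp Primrec.snd hl)))
    (Primrec.list_length.comp (Primrec.fst.comp (Primrec.snd.comp Primrec.fst)))).and ?_
  exact (primrecPred_levelRel.comp ((Primrec.snd.comp Primrec.fst).pair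
    (Primrec.snd.pair hl))).not

/-! ### Independence of disjoint blocks of coordinates -/

/-- The `σ`-algebra generated by the coordinates in `A`. -/
abbrev coordSigma (A : Set ℕ) : MeasurableSpace (Seq 3) :=
  ⨆ i ∈ A, MeasurableSpace.comap (fun x : Seq 3 => x i) inferInstance

theorem coordSigma_mono {A B : Set ℕ} (h : A ⊆ B) : coordSigma A ≤ coordSigma B :=
  biSup_mono h

theorem coordSigma_le (A : Set ℕ) : coordSigma A ≤ (inferInstance : MeasurableSpace (Seq 3)) :=
  iSup₂_le fun i _ => (measurable_pi_apply i).comap_le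

theorem measureReal_inter_of_disjoint {A B : Set ℕ} (h : Disjoint A B) {E F : Set (Seq 3)}
    (hE : MeasurableSet[coordSigma A] E) (hF : MeasurableSet[coordSigma B] F) :
    (lebesgue 3).real (E ∩ F) = (lebesgue 3).real E * (lebesgue 3).real F := by
  have hind : ProbabilityTheory.iIndepFun (fun (i : ℕ) (x : Seq 3) => x i) (lebesgue 3) :=
    ProbabilityTheory.iIndepFun_infinitePi
      (P := fun _ : ℕ => (PMF.uniformOfFintype (Fin 3)).toMeasure) (X := fun _ a => a)
      fun _ => measurable_id
  have := ProbabilityTheory.indep_iSup_of_disjoint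
    (fun i => (measurable_pi_apply i).comap_le) hind.iIndep h
  rw [ProbabilityTheory.Indep_iff] at this
  rw [measureReal_def, this E F hE hF, ENNReal.toReal_mul]
  rfl

theorem measurableSet_coordSigma_label {A : Set ℕ} {σ : List (Fin 2)} (h : strIndex σ - 1 ∈ A)
    (P : Fin 3 → Prop) : MeasurableSet[coordSigma A] {x | P (label x σ)} := by
  have hle : MeasurableSpace.comap (fun x : Seq 3 => x (strIndex σ - 1)) inferInstance ≤
      coordSigma A := le_iSup₂_of_le _ h le_rfl
  exact hle _ ⟨{a | P a}, MeasurableSet.of_discrete, rfl⟩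

/-- The coordinates that hold the labels of the strings extending the nonempty string `σ`. -/
def cone (σ : List (Fin 2)) : Set ℕ := {i | ∃ τ, i = strIndex (σ ++ τ) - 1}

/-- The coordinates that hold the labels of the strings properly extending `σ`. -/
def below (σ : List (Fin 2)) : Set ℕ := ⋃ b : Fin 2, cone (σ ++ [b])

theorem Incomp.ne_nil {σ τ : List (Fin 2)} (h : Incomp σ τ) : σ ≠ [] := by
  rintro rfl
  exact h.1 List.nil_prefix

theorem Incomp.disjoint_cone {σ τ : List (Fin 2)} (h : Incomp σ τ) :
    Disjoint (cone σ) (cone τ) := by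
  rw [Set.disjoint_left]
  rintro _ ⟨ρ, rfl⟩ ⟨ρ', h'⟩
  have h1 := strIndex_sub_one_inj (by simp [h.ne_nil]) (by simp [h.symm.ne_nil]) h'
  rcases List.prefix_or_prefix_of_prefix (List.prefix_append σ ρ)
    (h1 ▸ List.prefix_append τ ρ') with h2 | h2
  · exact h.1 h2
  · exact h.2 h2

theorem below_subset_cone (σ : List (Fin 2)) : below σ ⊆ cone σ := by
  refine Set.iUnion_subset fun b => ?_
  rintro _ ⟨τ, rfl⟩
  exact ⟨[b] ++ τ, by simp⟩

theorem cone_subset_below (σ : List (Fin 2)) (b : Fin 2) : cone (σ ++ [b]) ⊆ below σ :=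
  Set.subset_iUnion (fun b => cone (σ ++ [b])) b

theorem label_mem_cone (σ : List (Fin 2)) : strIndex σ - 1 ∈ cone σ := ⟨[], by simp⟩

theorem label_notMem_below {σ : List (Fin 2)} (h : σ ≠ []) : strIndex σ - 1 ∉ below σ := by
  simp only [below, Set.mem_iUnion, not_exists]
  rintro b ⟨τ, h'⟩
  have := congrArg List.length (strIndex_sub_one_inj h (by simp) h')
  simp at this

theorem Incomp.disjoint_below {σ τ : List (Fin 2)} (h : Incomp σ τ) :
    Disjoint (below σ) (below τ) :=
  h.disjoint_cone.mono (below_subset_cone σ) (below_subset_cone τ)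

theorem measurableSet_aliveTo (k : ℕ) (σ : List (Fin 2)) :
    MeasurableSet[coordSigma (below σ)] {x | AliveTo x k σ} := by
  induction k generalizing σ with
  | zero => exact @MeasurableSet.univ _ (coordSigma (below σ))
  | succ k ih =>
    have : {x | AliveTo x (k + 1) σ} =
        ⋃ b : Fin 2, {x | label x (σ ++ [b]) ≠ 1} ∩ {x | AliveTo x k (σ ++ [b])} := by
      ext x
      simp [AliveTo]
    rw [this]
    refine MeasurableSet.iUnion fun b => MeasurableSet.inter ?_ ?_
    · exact measurableSet_coordSigma_label (cone_subset_below σ b (label_mem_cone _)) (· ≠ 1)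
    · exact coordSigma_mono ((below_subset_cone _).trans (cone_subset_below σ b)) _ (ih _)

theorem measurableSet_alive (σ : List (Fin 2)) :
    MeasurableSet[coordSigma (below σ)] {x | Alive x σ} := by
  have : {x | Alive x σ} = ⋂ k, {x | AliveTo x k σ} := by
    ext x
    simp [Alive]
  rw [this]
  exact MeasurableSet.iInter fun k => measurableSet_aliveTo k σ

/-! ### The probability of survival -/

theorem measureReal_label_ne_one (σ : List (Fin 2)) :
    (lebesgue 3).real {x | label x σ ≠ 1} = 2 / 3 := by
  have h := lebesgue_coord (n := 3) {strIndex σ - 1} fun _ => {0, 2}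
  have h2 : {x : Seq 3 | ∀ i ∈ ({strIndex σ - 1} : Finset ℕ), x i ∈ ({0, 2} : Finset (Fin 3))} =
      {x | label x σ ≠ 1} := by
    ext x
    simp only [Finset.mem_singleton, forall_eq, Set.mem_ofPred_eq, label]
    generalize x (strIndex σ - 1) = a
    revert a
    decide
  rw [h2] at h
  rw [measureReal_def, h]
  simp

theorem measureReal_label_inter {σ : List (Fin 2)} (hσ : σ ≠ []) {E : Set (Seq 3)}
    (hE : MeasurableSet[coordSigma (below σ)] E) :
    (lebesgue 3).real ({x | label x σ ≠ 1} ∩ E) = 2 / 3 * (lebesgue 3).real E := by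
  rw [measureReal_inter_of_disjoint (A := {strIndex σ - 1}) (B := below σ) _ _ hE,
    measureReal_label_ne_one]
  · exact Set.disjoint_singleton_left.2 (label_notMem_below hσ)
  · exact measurableSet_coordSigma_label (Set.mem_singleton _) (· ≠ 1)

/-- The probability that a string survives for `k` levels. -/
noncomputable def survivalProb : ℕ → ℝ
  | 0 => 1
  | k + 1 => 4 / 3 * survivalProb k - 4 / 9 * survivalProb k ^ 2

theorem measurableSet_label_inter {σ : List (Fin 2)} {E : Set (Seq 3)}
    (hE : MeasurableSet[coordSigma (below σ)] E) :
    MeasurableSet[coordSigma (cone σ)] ({x | label x σ ≠ 1} ∩ E) :=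
  MeasurableSet.inter (measurableSet_coordSigma_label (label_mem_cone σ) (· ≠ 1))
    (coordSigma_mono (below_subset_cone σ) _ hE)

theorem incomp_children (σ : List (Fin 2)) : Incomp (σ ++ [0]) (σ ++ [1]) :=
  incomp_append_singleton σ (by decide)

/-- Inclusion–exclusion over the two children, which are independent because their cones are
disjoint: 2 · (2/3)p − ((2/3)p)². -/
theorem measureReal_aliveTo (k : ℕ) (σ : List (Fin 2)) :
    (lebesgue 3).real {x | AliveTo x k σ} = survivalProb k := by
  induction k generalizing σ with
  | zero => simp [AliveTo, survivalProb]
  | succ k ih =>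
    let E : Fin 2 → Set (Seq 3) := fun b =>
      {x | label x (σ ++ [b]) ≠ 1} ∩ {x | AliveTo x k (σ ++ [b])}
    have hE : {x | AliveTo x (k + 1) σ} = E 0 ∪ E 1 := by
      ext x
      simp [AliveTo, E, Fin.exists_fin_two]
    have hm : ∀ b, MeasurableSet[coordSigma (cone (σ ++ [b]))] (E b) := fun b =>
      measurableSet_label_inter (measurableSet_aliveTo k _)
    have hp : ∀ b, (lebesgue 3).real (E b) = 2 / 3 * survivalProb k := fun b => by
      rw [measureReal_label_inter (by simp) (measurableSet_aliveTo k _), ih]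
    have hu := measureReal_union_add_inter (μ := lebesgue 3) (s := E 0)
      (coordSigma_le _ _ (hm 1))
    rw [measureReal_inter_of_disjoint (incomp_children σ).disjoint_cone (hm 0) (hm 1), hp, hp,
      ← hE] at hu
    rw [survivalProb]
    linarith

/-- With p = 3/4 + e the recursion becomes e ↦ (2/3)e − (4/9)e². Thus e stays nonnegative and
shrinks at least by the factor 2/3 from its initial value 1/4. -/
theorem survivalProb_bounds (k : ℕ) :
    3 / 4 ≤ survivalProb k ∧ survivalProb k ≤ 3 / 4 + 1 / 4 * (2 / 3) ^ k := by
  have h : ∀ k, 3 / 4 ≤ survivalProb k ∧ survivalProb k ≤ 1 ∧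
      survivalProb k ≤ 3 / 4 + 1 / 4 * (2 / 3) ^ k := by
    intro k
    induction k with
    | zero => norm_num [survivalProb]
    | succ k ih =>
      obtain ⟨h1, h2, h3⟩ := ih
      simp only [survivalProb, pow_succ]
      refine ⟨?_, ?_, ?_⟩ <;> nlinarith
  exact ⟨(h k).1, (h k).2.2⟩

theorem measureReal_alive (σ : List (Fin 2)) : (lebesgue 3).real {x | Alive x σ} = 3 / 4 := by
  have hA : {x | Alive x σ} = ⋂ k, {x | AliveTo x k σ} := by
    ext x
    simp [Alive]
  have h1 : Filter.Tendsto (fun k => (lebesgue 3) {x | AliveTo x k σ}) Filter.atTop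
      (nhds ((lebesgue 3) {x | Alive x σ})) := by
    rw [hA]
    refine tendsto_measure_iInter_atTop
      (fun k => (coordSigma_le _ _ (measurableSet_aliveTo k σ)).nullMeasurableSet)
      (fun k l hkl x hx => AliveTo.anti hkl hx) ⟨0, measure_ne_top _ _⟩
  have h2 : Filter.Tendsto (fun k => (lebesgue 3).real {x | AliveTo x k σ}) Filter.atTop
      (nhds ((lebesgue 3).real {x | Alive x σ})) :=
    (ENNReal.tendsto_toReal (measure_ne_top _ _)).comp h1
  simp only [measureReal_aliveTo] at h2
  refine tendsto_nhds_unique h2 ?_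
  have h3 : Filter.Tendsto (fun k : ℕ => 3 / 4 + 1 / 4 * (2 / 3 : ℝ) ^ k) Filter.atTop
      (nhds (3 / 4 + 1 / 4 * 0)) :=
    ((tendsto_pow_atTop_nhds_zero_of_lt_one (by norm_num) (by norm_num)).const_mul _).const_add _
  rw [mul_zero, add_zero] at h3
  exact tendsto_of_tendsto_of_tendsto_of_le_of_le tendsto_const_nhds h3
    (fun k => (survivalProb_bounds k).1) fun k => (survivalProb_bounds k).2

theorem measure_aliveTo_diff_alive (m : ℕ) (σ : List (Fin 2)) :
    lebesgue 3 ({x | AliveTo x (2 * m) σ} \ {x | Alive x σ}) ≤ (2⁻¹ : ℝ≥0∞) ^ (m + 2) := by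
  have h := measureReal_sdiff (μ := lebesgue 3) (s₁ := {x | AliveTo x (2 * m) σ})
    (s₂ := {x | Alive x σ}) (fun x hx => hx _) (coordSigma_le _ _ (measurableSet_alive σ))
  rw [measureReal_aliveTo, measureReal_alive] at h
  have hb := (survivalProb_bounds (2 * m)).2
  -- Two levels gain a factor 4/9 ≤ 1/2; the initial factor 1/4 accounts for the extra 2 in the
  -- exponent.
  have hp : ((2 : ℝ) / 3) ^ (2 * m) ≤ (2⁻¹) ^ m := by
    rw [pow_mul]
    exact pow_le_pow_left₀ (by norm_num) (by norm_num) m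
  rw [← ofReal_measureReal, h]
  calc ENNReal.ofReal _ ≤ ENNReal.ofReal ((2⁻¹) ^ (m + 2)) := by
        refine ENNReal.ofReal_le_ofReal ?_
        rw [pow_add]
        linarith
    _ = (2⁻¹ : ℝ≥0∞) ^ (m + 2) := by
        rw [ENNReal.ofReal_pow (by norm_num), ENNReal.ofReal_inv_of_pos (by norm_num)]
        simp

theorem length_allStrings (n k : ℕ) : (allStrings n k).length = n ^ k := by
  induction k with
  | zero => simp [allStrings]
  | succ k ih => simp [allStrings, ih, pow_succ]

/-- This explains `lookahead`: with 2(2n+i) levels each of the 2^n strings of length n errs with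
probability at most 2^(-(2n+i+2)), and the sum over all n stays below 2^(-i). -/
theorem measure_not_reliable (i : ℕ) :
    lebesgue 3 {x | ¬Reliable i x} ≤ (2⁻¹ : ℝ≥0∞) ^ i := by
  have hsub : {x | ¬Reliable i x} ⊆ ⋃ n : ℕ, ⋃ σ ∈ (allStrings 2 n).toFinset,
      ({x | AliveTo x (lookahead i n) σ} \ {x | Alive x σ}) := by
    intro x hx
    simp only [Reliable, Set.mem_ofPred_eq, not_forall] at hx
    obtain ⟨σ, h1, h2⟩ := hx
    refine Set.mem_iUnion.2 ⟨σ.length, Set.mem_biUnion (x := σ) ?_ ⟨h1, h2⟩⟩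
    simp [mem_allStrings]
  have hone : ∀ n : ℕ, lebesgue 3 (⋃ σ ∈ (allStrings 2 n).toFinset,
      ({x | AliveTo x (lookahead i n) σ} \ {x | Alive x σ})) ≤
        (2⁻¹ : ℝ≥0∞) ^ i * (2⁻¹ : ℝ≥0∞) ^ (n + 1) := by
    intro n
    refine (measure_biUnion_finset_le _ _).trans ((Finset.sum_le_card_nsmul _ _ _
      fun σ _ => measure_aliveTo_diff_alive (2 * n + i) σ).trans ?_)
    rw [List.toFinset_card_of_nodup (nodup_allStrings 2 n), length_allStrings, nsmul_eq_mul]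
    have h1 : ((2 ^ n : ℕ) : ℝ≥0∞) * (2⁻¹ : ℝ≥0∞) ^ n = 1 := by
      push_cast
      rw [← mul_pow, ENNReal.mul_inv_cancel (by simp) (by simp), one_pow]
    calc ((2 ^ n : ℕ) : ℝ≥0∞) * (2⁻¹ : ℝ≥0∞) ^ (2 * n + i + 2)
        = ((2 ^ n : ℕ) * (2⁻¹ : ℝ≥0∞) ^ n) * (2⁻¹ : ℝ≥0∞) ^ (i + (n + 1) + 1) := by ring
      _ = (2⁻¹ : ℝ≥0∞) ^ (i + (n + 1) + 1) := by rw [h1, one_mul]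
      _ ≤ (2⁻¹ : ℝ≥0∞) ^ (i + (n + 1)) :=
        pow_le_pow_of_le_one (by simp) (by simp) (Nat.le_succ _)
      _ = _ := pow_add _ _ _
  calc lebesgue 3 {x | ¬Reliable i x} ≤ _ := measure_mono hsub
    _ ≤ ∑' n : ℕ, _ := measure_iUnion_le _
    _ ≤ ∑' n : ℕ, (2⁻¹ : ℝ≥0∞) ^ i * (2⁻¹ : ℝ≥0∞) ^ (n + 1) := ENNReal.tsum_le_tsum hone
    _ = (2⁻¹ : ℝ≥0∞) ^ i := by
      rw [ENNReal.tsum_mul_left, ENNReal.tsum_geometric_add_one, ENNReal.one_sub_inv_two, inv_inv,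
        ENNReal.inv_mul_cancel (by simp) (by simp), mul_one]

/-! ### The distribution of the code of the tree of surviving nodes -/

theorem measureReal_inter_forall_alive {A : Set ℕ} {E : Set (Seq 3)} {Q : List (List (Fin 2))}
    (hE : MeasurableSet[coordSigma A] E) (hA : ∀ σ ∈ Q, Disjoint A (below σ))
    (hQ : Q.Pairwise Incomp) :
    (lebesgue 3).real (E ∩ {x | ∀ σ ∈ Q, Alive x σ}) =
      (lebesgue 3).real E * (3 / 4) ^ Q.length := by
  induction Q generalizing A E with
  | nil => simp
  | cons σ Q ih =>
    rw [List.pairwise_cons] at hQ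
    have h1 : E ∩ {x | ∀ τ ∈ σ :: Q, Alive x τ} =
        (E ∩ {x | Alive x σ}) ∩ {x | ∀ τ ∈ Q, Alive x τ} := by
      ext x
      simp [and_assoc]
    rw [h1, ih (A := A ∪ below σ) _ _ hQ.2,
      measureReal_inter_of_disjoint (hA σ (by simp)) hE (measurableSet_alive σ),
      measureReal_alive, List.length_cons, pow_succ]
    · ring
    · exact MeasurableSet.inter (coordSigma_mono Set.subset_union_left _ hE)
        (coordSigma_mono Set.subset_union_right _ (measurableSet_alive σ))
    · intro τ hτ
      exact Set.disjoint_union_left.2 ⟨hA τ (by simp [hτ]), (hQ.1 τ hτ).disjoint_below⟩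

/-- The part of the event `Pattern x σ d` that is left when one disregards the survival of the
children listed in `children d σ`. -/
def patternBase (σ : List (Fin 2)) (d : Fin 3) : Set (Seq 3) :=
  {x | ∀ b : Fin 2, (σ ++ [b] ∈ children d σ → label x (σ ++ [b]) ≠ 1) ∧
    (σ ++ [b] ∉ children d σ → ¬(label x (σ ++ [b]) ≠ 1 ∧ Alive x (σ ++ [b])))}

theorem pattern_iff {x : Seq 3} {σ : List (Fin 2)} {d : Fin 3} :
    Pattern x σ d ↔ x ∈ patternBase σ d ∧ ∀ τ ∈ children d σ, Alive x τ := by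
  constructor
  · intro h
    exact ⟨fun b => ⟨fun hb => ((h b).2 hb).1, fun hb hx => hb ((h b).1 hx)⟩,
      fun τ hτ => h.alive_child hτ⟩
  · rintro ⟨h1, h2⟩ b
    by_cases hb : σ ++ [b] ∈ children d σ
    · simp only [hb, iff_true]
      exact ⟨(h1 b).1 hb, h2 _ hb⟩
    · simp only [hb, iff_false]
      exact (h1 b).2 hb

/-- The coordinates on which `patternBase σ d` depends. -/
def patternCoords (σ : List (Fin 2)) (d : Fin 3) : Set ℕ :=
  {i | ∃ b : Fin 2, (σ ++ [b] ∈ children d σ ∧ i = strIndex (σ ++ [b]) - 1) ∨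
    (σ ++ [b] ∉ children d σ ∧ i ∈ cone (σ ++ [b]))}

theorem patternCoords_subset (σ : List (Fin 2)) (d : Fin 3) : patternCoords σ d ⊆ below σ := by
  rintro i ⟨b, ⟨-, rfl⟩ | ⟨-, h⟩⟩
  · exact cone_subset_below σ b (label_mem_cone _)
  · exact cone_subset_below σ b h

/-- A child in the pattern contributes only its own label, a child outside it contributes its whole
cone. The survival of the listed children thus stays independent of `patternBase`. -/
theorem disjoint_patternCoords {σ τ : List (Fin 2)} {d : Fin 3} (hτ : τ ∈ children d σ) :
    Disjoint (patternCoords σ d) (below τ) := by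
  obtain ⟨c, rfl, hc⟩ := mem_children.1 hτ
  rw [Set.disjoint_left]
  rintro i ⟨b, h⟩ hi
  by_cases hbc : b = c
  · subst hbc
    rcases h with ⟨-, rfl⟩ | ⟨h, -⟩
    · exact label_notMem_below (by simp) hi
    · exact h hc
  · have hin : i ∈ cone (σ ++ [b]) := by
      rcases h with ⟨-, rfl⟩ | ⟨-, h⟩
      · exact label_mem_cone _
      · exact h
    exact Set.disjoint_left.1 (incomp_append_singleton σ hbc).disjoint_cone hin
      (below_subset_cone _ hi)

theorem measurableSet_patternBase (σ : List (Fin 2)) (d : Fin 3) :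
    MeasurableSet[coordSigma (patternCoords σ d)] (patternBase σ d) := by
  have h : patternBase σ d = ⋂ b : Fin 2,
      {x | (σ ++ [b] ∈ children d σ → label x (σ ++ [b]) ≠ 1) ∧
        (σ ++ [b] ∉ children d σ → ¬(label x (σ ++ [b]) ≠ 1 ∧ Alive x (σ ++ [b])))} := by
    ext x
    simp [patternBase]
  rw [h]
  refine MeasurableSet.iInter fun b => ?_
  by_cases hb : σ ++ [b] ∈ children d σ
  · simp only [hb, true_imp_iff, not_true_eq_false, false_imp_iff, and_true]
    have hmem : strIndex (σ ++ [b]) - 1 ∈ patternCoords σ d := ⟨b, Or.inl ⟨hb, rfl⟩⟩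
    exact measurableSet_coordSigma_label hmem (· ≠ 1)
  · simp only [hb, not_false_eq_true, true_imp_iff, false_imp_iff, true_and]
    have hsub : cone (σ ++ [b]) ⊆ patternCoords σ d := fun i hi => ⟨b, Or.inr ⟨hb, hi⟩⟩
    exact (coordSigma_mono hsub _ (measurableSet_label_inter (measurableSet_alive _))).compl

/-- A child is permitted and survives with probability 2/3 · 3/4 = 1/2, so all three patterns have
probability 1/4. Here this appears as 2/3 · 1/2 · 3/4 for one child and (2/3)² · (3/4)² for two. -/
theorem measureReal_patternBase (σ : List (Fin 2)) (d : Fin 3) :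
    (lebesgue 3).real (patternBase σ d) * (3 / 4) ^ (children d σ).length = 1 / 4 := by
  let L : Fin 2 → Set (Seq 3) := fun b => {x | label x (σ ++ [b]) ≠ 1}
  let E : Fin 2 → Set (Seq 3) := fun b => L b ∩ {x | Alive x (σ ++ [b])}
  have hL : ∀ b, MeasurableSet[coordSigma (cone (σ ++ [b]))] (L b) := fun b =>
    measurableSet_coordSigma_label (label_mem_cone _) (· ≠ 1)
  have hE : ∀ b, MeasurableSet[coordSigma (cone (σ ++ [b]))] (E b) := fun b =>
    measurableSet_label_inter (measurableSet_alive _)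
  have hLp : ∀ b, (lebesgue 3).real (L b) = 2 / 3 := fun b => measureReal_label_ne_one _
  have hEp : ∀ b, (lebesgue 3).real (E b)ᶜ = 1 / 2 := fun b => by
    rw [measureReal_compl (coordSigma_le _ _ (hE b)),
      measureReal_label_inter (by simp) (measurableSet_alive _), measureReal_alive]
    norm_num
  have hdisj := (incomp_children σ).disjoint_cone
  fin_cases d
  · have : patternBase σ 0 = L 0 ∩ (E 1)ᶜ := by
      ext x
      simp [patternBase, children, L, E, Fin.forall_fin_two]
    change (lebesgue 3).real (patternBase σ 0) * _ = _
    rw [this, measureReal_inter_of_disjoint hdisj (hL 0) (hE 1).compl, hLp, hEp]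
    norm_num [children]
  · have : patternBase σ 1 = (E 0)ᶜ ∩ L 1 := by
      ext x
      simp [patternBase, children, L, E, Fin.forall_fin_two]
    change (lebesgue 3).real (patternBase σ 1) * _ = _
    rw [this, measureReal_inter_of_disjoint hdisj (hE 0).compl (hL 1), hLp, hEp]
    norm_num [children]
  · have : patternBase σ 2 = L 0 ∩ L 1 := by
      ext x
      simp [patternBase, children, L, Fin.forall_fin_two]
    change (lebesgue 3).real (patternBase σ 2) * _ = _
    rw [this, measureReal_inter_of_disjoint hdisj (hL 0) (hL 1), hLp, hLp]
    norm_num [children]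

/-- The invariant of the breadth-first exploration: what has been learned, E, is independent of the
survival of the queued nodes, each of which contributes a factor 3/4. One step replaces the survival
of the first node, of probability 3/4, by a given pattern, of probability 1/4, so the total is
multiplied by 1/3. -/
theorem exists_codesTo_decomposition (z : Seq 3) (n : ℕ) :
    ∃ (A : Set ℕ) (E : Set (Seq 3)), MeasurableSet[coordSigma A] E ∧
      (∀ σ ∈ queue z n, Disjoint A (below σ)) ∧
      {x | CodesTo x z n} = E ∩ {x | ∀ σ ∈ queue z n, Alive x σ} ∧
      (lebesgue 3).real E * (3 / 4) ^ (queue z n).length = 3 / 4 * (3⁻¹) ^ n := by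
  induction n with
  | zero =>
    refine ⟨∅, Set.univ, @MeasurableSet.univ _ (coordSigma ∅), fun _ _ => Set.empty_disjoint _,
      ?_, by simp [queue]⟩
    ext x
    simp [CodesTo, queue]
  | succ n ih =>
    obtain ⟨A, E, hE, hA, hC, hp⟩ := ih
    have hpw := pairwise_incomp_queue z n
    rw [queue_eq_cons] at hA hC hp hpw
    rw [List.pairwise_cons] at hpw
    set σ := node z n with hσ
    set Q := (queue z n).tail with hQ
    have hAσ : Disjoint A (below σ) := hA σ (by simp)
    have hchild : ∀ τ ∈ children (z n) σ, below τ ⊆ below σ := by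
      intro τ hτ
      obtain ⟨b, rfl, -⟩ := mem_children.1 hτ
      exact (below_subset_cone _).trans (cone_subset_below σ b)
    refine ⟨A ∪ patternCoords σ (z n), E ∩ patternBase σ (z n), ?_, ?_, ?_, ?_⟩
    · exact MeasurableSet.inter (coordSigma_mono Set.subset_union_left _ hE)
        (coordSigma_mono Set.subset_union_right _ (measurableSet_patternBase σ (z n)))
    · intro τ hτ
      rw [queue_succ, List.mem_append] at hτ
      refine Set.disjoint_union_left.2 ?_
      rcases hτ with hτ | hτ
      · exact ⟨hA τ (List.mem_cons_of_mem _ hτ),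
          (hpw.1 τ hτ).disjoint_below.mono_left (patternCoords_subset σ (z n))⟩
      · exact ⟨hAσ.mono_right (hchild τ hτ), disjoint_patternCoords hτ⟩
    · ext x
      have h1 : CodesTo x z (n + 1) ↔ CodesTo x z n ∧ Pattern x σ (z n) := by
        simp only [CodesTo, Nat.forall_lt_succ_right, and_assoc, hσ]
      have h2 : CodesTo x z n ↔ x ∈ E ∧ ∀ τ ∈ σ :: Q, Alive x τ := Set.ext_iff.1 hC x
      simp only [Set.mem_ofPred_eq, Set.mem_inter_iff, h1, h2, queue_succ, List.mem_append,
        List.mem_cons]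
      constructor
      · rintro ⟨⟨hx, hal⟩, hpat⟩
        rw [pattern_iff] at hpat
        exact ⟨⟨hx, hpat.1⟩, fun τ hτ => hτ.elim (fun h => hal τ (Or.inr h)) (hpat.2 τ)⟩
      · rintro ⟨⟨hx, hb⟩, hal⟩
        have hpat : Pattern x σ (z n) := pattern_iff.2 ⟨hb, fun τ hτ => hal τ (Or.inr hτ)⟩
        refine ⟨⟨hx, fun τ hτ => ?_⟩, hpat⟩
        rcases hτ with rfl | hτ
        · exact hpat.alive
        · exact hal τ (Or.inl hτ)
    · have hb := measureReal_patternBase σ (z n)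
      rw [measureReal_inter_of_disjoint (hAσ.mono_right (patternCoords_subset σ (z n))) hE
        (measurableSet_patternBase σ (z n)), queue_succ, List.length_append, pow_add, pow_succ]
      rw [List.length_cons, pow_succ] at hp
      -- The factor 4/3 removes the survival factor of σ, now subsumed in its pattern.
      calc (lebesgue 3).real E * (lebesgue 3).real (patternBase σ (z n)) *
            ((3 / 4) ^ Q.length * (3 / 4) ^ (children (z n) σ).length)
          = ((lebesgue 3).real E * ((3 / 4) ^ Q.length * (3 / 4))) * (4 / 3) *
            ((lebesgue 3).real (patternBase σ (z n)) *
              (3 / 4) ^ (children (z n) σ).length) := by ring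
        _ = _ := by
          rw [hp, hb]
          ring

theorem measurableSet_codesTo (z : Seq 3) (n : ℕ) : MeasurableSet {x | CodesTo x z n} := by
  obtain ⟨A, E, hE, -, hC, -⟩ := exists_codesTo_decomposition z n
  have h : {x | ∀ σ ∈ queue z n, Alive x σ} = ⋂ σ ∈ {σ | σ ∈ queue z n}, {x | Alive x σ} := by
    ext x
    simp
  rw [hC, h]
  exact (coordSigma_le _ _ hE).inter (MeasurableSet.biInter (Set.to_countable _)
    fun σ _ => coordSigma_le _ _ (measurableSet_alive σ))

theorem measure_codesTo (z : Seq 3) (n : ℕ) :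
    lebesgue 3 {x | CodesTo x z n} = ENNReal.ofReal (3 / 4) * (3⁻¹ : ℝ≥0∞) ^ n := by
  obtain ⟨A, E, hE, hA, hC, hp⟩ := exists_codesTo_decomposition z n
  rw [← ofReal_measureReal, hC, measureReal_inter_forall_alive hE hA (pairwise_incomp_queue z n),
    hp, ENNReal.ofReal_mul (by norm_num), ENNReal.ofReal_pow (by norm_num),
    ENNReal.ofReal_inv_of_pos (by norm_num)]
  simp

/-- The sets of sequences with a given initial segment. -/
def cylinderSets (n : ℕ) : Set (Set (Seq n)) :=
  {C | ∃ s : List (Fin n), C = {x | initSeg x s.length = s}}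

theorem generateFrom_cylinderSets (n : ℕ) :
    (inferInstance : MeasurableSpace (Seq n)) = MeasurableSpace.generateFrom (cylinderSets n) := by
  refine le_antisymm ?_ (MeasurableSpace.generateFrom_le ?_)
  · refine iSup_le fun i => ?_
    rintro _ ⟨t, -, rfl⟩
    have h : (fun x : Seq n => x i) ⁻¹' t =
        ⋃ s ∈ {s : List (Fin n) | ∃ x : Seq n, x i ∈ t ∧ s = initSeg x (i + 1)},
          {x | initSeg x s.length = s} := by
      ext x
      simp only [Set.mem_preimage, Set.mem_iUnion, Set.mem_ofPred_eq, exists_prop]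
      constructor
      · intro hx
        exact ⟨_, ⟨x, hx, rfl⟩, by simp⟩
      · rintro ⟨s, ⟨y, hy, rfl⟩, h⟩
        rw [length_initSeg, initSeg_eq_initSeg] at h
        rwa [h i (Nat.lt_succ_self i)]
    rw [h]
    exact MeasurableSet.biUnion (Set.to_countable _)
      fun s _ => MeasurableSpace.measurableSet_generateFrom ⟨s, rfl⟩
  · rintro _ ⟨s, rfl⟩
    exact measurableSet_initSeg s.length (· = s)

theorem isPiSystem_cylinderSets (n : ℕ) : IsPiSystem (cylinderSets n) := by
  have key : ∀ s t : List (Fin n), s.length ≤ t.length →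
      ({x : Seq n | initSeg x s.length = s} ∩ {x | initSeg x t.length = t}).Nonempty →
      {x : Seq n | initSeg x s.length = s} ∩ {x | initSeg x t.length = t} ∈ cylinderSets n := by
    rintro s t hle ⟨x, hs, ht⟩
    refine ⟨t, Set.inter_eq_right.2 fun y hy => ?_⟩
    simp only [Set.mem_ofPred_eq] at hs ht hy ⊢
    rw [← take_initSeg y hle, hy, ← ht, take_initSeg x hle, hs]
  rintro _ ⟨s, rfl⟩ _ ⟨t, rfl⟩ hne
  rcases le_total s.length t.length with h | h
  · exact key s t h hne
  · rw [Set.inter_comm] at hne ⊢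
    exact key t s h hne

theorem measurableSet_alive_nil : MeasurableSet {x | Alive x []} :=
  coordSigma_le _ _ (measurableSet_alive [])

theorem alive_inter_preimage_aliveCode (s : List (Fin 3)) :
    {x | Alive x []} ∩ aliveCode ⁻¹' {z | initSeg z s.length = s} =
      {x | CodesTo x (extend s) s.length} := by
  ext x
  simp only [Set.mem_inter_iff, Set.mem_preimage, Set.mem_ofPred_eq]
  rw [codesTo_iff, initSeg_extend]

theorem measurable_aliveCode : Measurable aliveCode := by
  have hgen : Measurable[inferInstance, MeasurableSpace.generateFrom (cylinderSets 3)] aliveCode ↔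
      Measurable aliveCode := by
    rw [← generateFrom_cylinderSets 3]
  refine hgen.1 (measurable_generateFrom ?_)
  rintro _ ⟨s, rfl⟩
  -- Where the root does not survive, `aliveCode` is constantly the zero sequence, so that part of
  -- the preimage is all or nothing.
  have h : aliveCode ⁻¹' {z | initSeg z s.length = s} =
      {x | CodesTo x (extend s) s.length} ∪
        ({x | Alive x []}ᶜ ∩ {_x | initSeg (0 : Seq 3) s.length = s}) := by
    rw [← alive_inter_preimage_aliveCode]
    ext x
    by_cases hx : Alive x [] <;> simp [hx, aliveCode]
  rw [h]
  exact (measurableSet_codesTo _ _).union (measurableSet_alive_nil.compl.inter (.const _))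

theorem map_aliveCode :
    ((lebesgue 3).restrict {x | Alive x []}).map aliveCode =
      ENNReal.ofReal (3 / 4) • lebesgue 3 := by
  have hcyl : ∀ s : List (Fin 3),
      ((lebesgue 3).restrict {x | Alive x []}).map aliveCode {z | initSeg z s.length = s} =
        (ENNReal.ofReal (3 / 4) • lebesgue 3) {z | initSeg z s.length = s} := by
    intro s
    have hs : MeasurableSet {z : Seq 3 | initSeg z s.length = s} :=
      measurableSet_initSeg s.length (· = s)
    rw [Measure.map_apply measurable_aliveCode hs,
      Measure.restrict_apply (measurable_aliveCode hs), Set.inter_comm,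
      alive_inter_preimage_aliveCode, measure_codesTo, Measure.smul_apply, lebesgue_initSeg_eq]
    simp
  refine ext_of_generate_finite (cylinderSets 3) (generateFrom_cylinderSets 3)
    (isPiSystem_cylinderSets 3) ?_ ?_
  · rintro _ ⟨s, rfl⟩
    exact hcyl s
  · simpa [initSeg] using hcyl []

theorem measure_alive_inter_preimage {U : Set (Seq 3)} (hU : MeasurableSet U) :
    lebesgue 3 ({x | Alive x []} ∩ aliveCode ⁻¹' U) = ENNReal.ofReal (3 / 4) * lebesgue 3 U := by
  have h := congrArg (fun μ : Measure (Seq 3) => μ U) map_aliveCode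
  simpa only [Measure.map_apply measurable_aliveCode hU,
    Measure.restrict_apply (measurable_aliveCode hU), Measure.smul_apply, smul_eq_mul,
    Set.inter_comm] using h

/-! ### Totality of random continuous functions -/

/-- Some string of length `k` can be appended to `σ` meeting only the label `2`. -/
def TwoPath (x : Seq 3) (σ : List (Fin 2)) (k : ℕ) : Prop :=
  ∃ τ ∈ allStrings 2 k, ∀ j < k, label x (σ ++ τ.take (j + 1)) = 2

theorem twoPath_congr {x y : Seq 3} {m : ℕ} (h : ∀ i < m, x i = y i) {σ : List (Fin 2)} {k : ℕ}
    (hm : 2 ^ (σ.length + k + 1) ≤ m) : TwoPath x σ k ↔ TwoPath y σ k := by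
  refine exists_congr fun τ => and_congr_right fun hτ => forall₂_congr fun j hj => ?_
  rw [mem_allStrings] at hτ
  rw [label_congr h ((Nat.pow_le_pow_right (by norm_num) _).trans hm)]
  simp only [List.length_append, List.length_take]
  omega

/-- The k strings along τ have different lengths, so their labels are k distinct digits of x. -/
theorem measure_twoPath_along (σ τ : List (Fin 2)) {k : ℕ} (hτ : τ.length = k) :
    lebesgue 3 {x | ∀ j < k, label x (σ ++ τ.take (j + 1)) = 2} = (3⁻¹ : ℝ≥0∞) ^ k := by
  have hinj : Set.InjOn (fun j => strIndex (σ ++ τ.take (j + 1)) - 1) (Finset.range k) := by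
    intro i hi j hj hij
    have hne : ∀ j ∈ (Finset.range k : Set ℕ), σ ++ τ.take (j + 1) ≠ [] := by
      intro j hj h
      have := congrArg List.length h
      simp only [Finset.coe_range, Set.mem_Iio] at hj
      simp only [List.length_append, List.length_take, List.length_nil] at this
      omega
    have := congrArg List.length (strIndex_sub_one_inj (hne i hi) (hne j hj) hij)
    simp only [Finset.coe_range, Set.mem_Iio] at hi hj
    simp only [List.length_append, List.length_take] at this
    omega
  have h := lebesgue_coord (n := 3)
    ((Finset.range k).image fun j => strIndex (σ ++ τ.take (j + 1)) - 1) fun _ => {2}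
  rw [Finset.prod_const, Finset.card_image_of_injOn hinj, Finset.card_range] at h
  rw [show (3⁻¹ : ℝ≥0∞) = ((({2} : Finset (Fin 3)).card : ℕ) : ℝ≥0∞) / (3 : ℕ) by simp, ← h]
  congr 1
  ext x
  simp [label]

theorem measure_twoPath_le (σ : List (Fin 2)) (i : ℕ) :
    lebesgue 3 {x | TwoPath x σ (2 * i)} ≤ (2⁻¹ : ℝ≥0∞) ^ i := by
  have h : {x | TwoPath x σ (2 * i)} = ⋃ τ ∈ (allStrings 2 (2 * i)).toFinset,
      {x | ∀ j < 2 * i, label x (σ ++ τ.take (j + 1)) = 2} := by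
    ext x
    simp [TwoPath]
  rw [h]
  refine (measure_biUnion_finset_le _ _).trans ((Finset.sum_le_card_nsmul _ _ _ fun τ hτ =>
    (measure_twoPath_along σ τ ?_).le).trans ?_)
  · simpa [mem_allStrings] using hτ
  · rw [List.toFinset_card_of_nodup (nodup_allStrings 2 _), length_allStrings, nsmul_eq_mul]
    have h3 : ENNReal.ofReal 3⁻¹ = 3⁻¹ := by
      rw [ENNReal.ofReal_inv_of_pos (by norm_num)]
      simp
    have h2 : ENNReal.ofReal 2⁻¹ = 2⁻¹ := by
      rw [ENNReal.ofReal_inv_of_pos (by norm_num)]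
      simp
    rw [← h3, ← h2, ← ENNReal.ofReal_pow (by norm_num), ← ENNReal.ofReal_pow (by norm_num),
      ← ENNReal.ofReal_natCast, ← ENNReal.ofReal_mul (by positivity)]
    refine ENNReal.ofReal_le_ofReal ?_
    push_cast
    rw [← mul_pow, pow_mul]
    exact pow_le_pow_left₀ (by norm_num) (by norm_num) i

/-- With k = 2i the union bound is (4/9)^i ≤ 2^(-i), so the events for a fixed σ form a Martin-Löf
test. -/
theorem exists_not_twoPath {x : Seq 3} (hx : x ∈ MLR (lebesgue 3)) (σ : List (Fin 2)) :
    ∃ k, ¬TwoPath x σ k := by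
  let P : ℕ → List (Fin 3) → Prop := fun i s =>
    2 ^ (σ.length + 2 * i + 1) ≤ s.length ∧ TwoPath (extend s) σ (2 * i)
  have hiff : ∀ i (x : Seq 3), (∃ m, P i (initSeg x m)) ↔ TwoPath x σ (2 * i) := by
    intro i x
    constructor
    · rintro ⟨m, hm, h⟩
      rw [length_initSeg] at hm
      exact (twoPath_congr (fun j hj => extend_initSeg x hj) hm).1 h
    · intro h
      refine ⟨2 ^ (σ.length + 2 * i + 1), by simp, ?_⟩
      exact (twoPath_congr (fun j hj => extend_initSeg x hj) le_rfl).2 h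
  have hP : PrimrecPred fun p : ℕ × List (Fin 3) => P p.1 p.2 := by
    have h2i : Primrec fun p : ℕ × List (Fin 3) => 2 * p.1 :=
      Primrec.nat_mul.comp (Primrec.const 2) Primrec.fst
    refine (Primrec.nat_le.comp (primrec_pow.comp (Primrec.const 2)
      (Primrec.succ.comp (Primrec.nat_add.comp (Primrec.const σ.length) h2i)))
      (Primrec.list_length.comp Primrec.snd)).and ?_
    refine primrecPred_exists_mem (f := fun p : ℕ × List (Fin 3) => allStrings 2 (2 * p.1))
      (p := fun p τ => ∀ j < 2 * p.1, label (extend p.2) (σ ++ τ.take (j + 1)) = 2)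
      ((primrec_allStrings 2).comp h2i) ?_
    refine primrecPred_forall_lt
      (f := fun q : (ℕ × List (Fin 3)) × List (Fin 2) => 2 * q.1.1)
      (p := fun q j => label (extend q.1.2) (σ ++ q.2.take (j + 1)) = 2)
      (h2i.comp Primrec.fst) ?_
    exact Primrec.eq.comp (primrec_label.comp
      (Primrec.snd.comp (Primrec.fst.comp Primrec.fst))
      (Primrec.list_append.comp (Primrec.const σ) (Primrec.list_take.comp
        (Primrec.succ.comp Primrec.snd) (Primrec.snd.comp Primrec.fst)))) (Primrec.const 2)
  have htest : IsMLTest (lebesgue 3) fun i => {x | ∃ m, P i (initSeg x m)} := by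
    refine ⟨uniformlySigma01_of_primrecPred hP, fun i => ?_⟩
    simp only [hiff]
    exact measure_twoPath_le σ i
  have := hx _ htest
  simp only [Set.mem_iInter, not_forall, Set.mem_ofPred_eq, hiff] at this
  obtain ⟨i, hi⟩ := this
  exact ⟨_, hi⟩

theorem infinite_labelSeq_ne_two {x : Seq 3} (hx : x ∈ MLR (lebesgue 3)) (y : Seq 2) :
    {k | labelSeq x y k ≠ 2}.Infinite := by
  refine Set.infinite_of_forall_exists_gt fun n => ?_
  by_contra! hcon
  obtain ⟨k, hk⟩ := exists_not_twoPath hx (initSeg y (n + 1))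
  -- If all labels along y after position n were 2, then y itself would supply 2-paths of every
  -- length above its initial segment of length n+1.
  refine hk ⟨(initSeg y (n + 1 + k)).drop (n + 1), mem_allStrings.2 (by simp), fun j hj => ?_⟩
  have h1 : initSeg y (n + 1) ++ ((initSeg y (n + 1 + k)).drop (n + 1)).take (j + 1) =
      initSeg y (n + 1 + (j + 1)) := by
    rw [← take_initSeg y (show n + 1 + (j + 1) ≤ n + 1 + k by omega),
      List.take_add (i := n + 1),
      take_initSeg y (by omega)]
  rw [h1]
  by_contra h2
  have := hcon (n + 1 + j) h2
  omega

/-! ### Zero sets of coded functions -/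

theorem codedFun_get_eq_zero {x : Seq 3} {y : Seq 2} (h : (codedFun x y).Dom) :
    (codedFun x y).get h = (fun _ => 0) ↔ ∀ k, labelSeq x y k ≠ 1 := by
  have hget : ∀ j, (codedFun x y).get h j =
    if labelSeq x y (Nat.nth (fun k => labelSeq x y k ≠ 2) j) = 1 then 1 else 0 := fun _ => rfl
  rw [funext_iff]
  simp only [hget, ite_eq_right_iff, one_ne_zero, imp_false]
  constructor
  · intro hj k hk
    -- A label 1 is not deleted, so position k reappears in the output at the place given by the
    -- number of retained labels before it.
    refine hj (Nat.count (fun k => labelSeq x y k ≠ 2) k) ?_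
    rw [Nat.nth_count (by rw [hk]; decide), hk]
  · exact fun hk j => hk _

theorem good_initSeg {x : Seq 3} {y : Seq 2} {n : ℕ} :
    Good x (initSeg y n) ↔ ∀ k < n, labelSeq x y k ≠ 1 := by
  rw [Good, length_initSeg]
  refine forall₂_congr fun k hk => ?_
  rw [take_initSeg y (by omega), labelSeq]

theorem alive_initSeg {x : Seq 3} {y : Seq 2} (h : ∀ k, labelSeq x y k ≠ 1) (n : ℕ) :
    Alive x (initSeg y n) := fun k =>
  (good_and_aliveTo_iff.2 ⟨initSeg y (n + k), by simp, good_initSeg.2 fun j _ => h j,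
    by rw [length_initSeg, take_initSeg y (by omega)]⟩).2

theorem Codes.paths_eq {x z : Seq 3} (h : Codes x z) :
    paths (codedTree z) = {y | ∀ k, labelSeq x y k ≠ 1} := by
  ext y
  simp only [paths, Set.mem_ofPred_eq, h.mem_codedTree]
  constructor
  · exact fun hy k => good_initSeg.1 (hy (k + 1)).1 k (Nat.lt_succ_self k)
  · exact fun hy k => ⟨good_initSeg.2 fun j _ => hy j, alive_initSeg hy k⟩

/-! ### Transfer of randomness -/

theorem UniformlySigma01.measurableSet {n : ℕ} {U : ℕ → Set (Seq n)} (h : UniformlySigma01 U)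
    (i : ℕ) : MeasurableSet (U i) := by
  obtain ⟨c, hc⟩ := h.exists_code
  rw [hc, Set.ofPred_exists]
  exact MeasurableSet.iUnion fun m => measurableSet_initSeg m (Hits c i)

theorem codesRel_of_forall_not_refutes {i : ℕ} {x z : Seq 3}
    (h : ¬∃ m, Refutes i (initSeg x m) (initSeg z m)) : CodesRel i x z :=
  codesRel_iff.2 (not_exists.1 h)

theorem inv_two_pow_succ_add (i : ℕ) :
    (2⁻¹ : ℝ≥0∞) ^ (i + 1) + (2⁻¹ : ℝ≥0∞) ^ (i + 1) = (2⁻¹ : ℝ≥0∞) ^ i := by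
  rw [pow_succ, ← mul_add, ENNReal.inv_two_add_inv_two, mul_one]

theorem ofReal_three_quarters_le : ENNReal.ofReal (3 / 4) ≤ 1 := by
  rw [ENNReal.ofReal_le_one]
  norm_num

theorem inv_two_le_ofReal : (2⁻¹ : ℝ≥0∞) ≤ ENNReal.ofReal (3 / 4) := by
  rw [show (2⁻¹ : ℝ≥0∞) = ENNReal.ofReal 2⁻¹ by
    rw [ENNReal.ofReal_inv_of_pos (by norm_num)]; simp]
  exact ENNReal.ofReal_le_ofReal (by norm_num)

/-- The pulled-back test consists of the x all of whose unrefuted codes lie in U. For reliable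
surviving x the code `aliveCode x` is never refuted, so it lies in U, and `map_aliveCode` bounds the
measure. Conversely an unrefuted z can only be `aliveCode x`, so x passes into every component when
its code is in all U_i. -/
theorem aliveCode_mem_MLR {x : Seq 3} (hx : x ∈ MLR (lebesgue 3)) (hal : Alive x []) :
    aliveCode x ∈ MLR (lebesgue 3) := by
  intro U hU hz
  -- If the root does not survive, every z gets refuted and the condition on z holds for free.
  -- Requiring survival up to the lookahead excludes such x, apart from unreliable ones.
  let A : ℕ → List (Fin 3) → Prop := fun i s => 2 ^ (lookahead (i + 1) 0 + 1) ≤ s.length ∧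
    ∃ τ ∈ allStrings 2 (lookahead (i + 1) 0), Good (extend s) τ
  let B : ℕ → List (Fin 3) → List (Fin 3) → Prop := fun i s t => Refutes (i + 1) s t
  have hAiff : ∀ i (x : Seq 3) m, A i (initSeg x m) ↔
      2 ^ (lookahead (i + 1) 0 + 1) ≤ m ∧ AliveTo x (lookahead (i + 1) 0) [] := by
    intro i x m
    have h1 : AliveTo x (lookahead (i + 1) 0) [] ↔
        ∃ τ ∈ allStrings 2 (lookahead (i + 1) 0), Good x τ := by
      have := good_and_aliveTo_iff (x := x) (k := lookahead (i + 1) 0) (σ := [])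
      simpa [good_nil, mem_allStrings] using this
    rw [h1]
    simp only [A, length_initSeg]
    refine and_congr_right fun hm => exists_congr fun τ => and_congr_right fun hτ => ?_
    exact good_congr (fun j hj => extend_initSeg x hj) (by rwa [mem_allStrings.1 hτ])
  have hA : PrimrecPred fun p : ℕ × List (Fin 3) => A p.1 p.2 := by
    have hl : Primrec fun p : ℕ × List (Fin 3) => lookahead (p.1 + 1) 0 :=
      primrec_lookahead.comp (Primrec.succ.comp Primrec.fst) (Primrec.const 0)
    exact (Primrec.nat_le.comp (primrec_pow.comp (Primrec.const 2) (Primrec.succ.comp hl))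
      (Primrec.list_length.comp Primrec.snd)).and (primrecPred_exists_mem
        (p := fun (p : ℕ × List (Fin 3)) τ => Good (extend p.2) τ)
        ((primrec_allStrings 2).comp hl) (primrecPred_good.comp
          ((Primrec.snd.comp Primrec.fst).pair Primrec.snd)))
  have hB : PrimrecPred fun p : (ℕ × List (Fin 3)) × List (Fin 3) => B p.1.1 p.1.2 p.2 :=
    primrecPred_refutes.comp ((Primrec.succ.comp (Primrec.fst.comp Primrec.fst)).pair
      ((Primrec.snd.comp Primrec.fst).pair Primrec.snd))
  have hV := uniformlySigma01_forall hU.uniform 1 hA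
    (fun i x m l hml h => (hAiff i x l).2 ⟨((hAiff i x m).1 h).1.trans hml, ((hAiff i x m).1 h).2⟩)
    hB (fun i x z m l hml => Refutes.mono hml)
  refine hx _ ⟨hV, fun i => ?_⟩ (Set.mem_iInter.2 fun i => ?_)
  · have hsub : {x : Seq 3 | (∃ m, A i (initSeg x m)) ∧
        ∀ z, z ∈ U (i + 1) ∨ ∃ m, B i (initSeg x m) (initSeg z m)} ⊆
        {x | ¬Reliable (i + 1) x} ∪ ({x | Alive x []} ∩ aliveCode ⁻¹' U (i + 1)) := by
      rintro x ⟨⟨m, hm⟩, h⟩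
      by_cases hr : Reliable (i + 1) x
      · have hal := hr [] ((hAiff i x m).1 hm).2
        refine Or.inr ⟨hal, (h (aliveCode x)).resolve_right ?_⟩
        exact not_exists.2 (codesRel_iff.1 ((codes_aliveCode hal).codesRel hr))
      · exact Or.inl hr
    refine (measure_mono hsub).trans ((measure_union_le _ _).trans ?_)
    rw [measure_alive_inter_preimage (hU.uniform.measurableSet _), ← inv_two_pow_succ_add]
    refine add_le_add (measure_not_reliable _) ?_
    exact (mul_le_of_le_one_left' ofReal_three_quarters_le).trans (hU.small _)
  · refine ⟨⟨_, (hAiff i x _).2 ⟨le_rfl, hal _⟩⟩, fun z => ?_⟩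
    by_contra! hcon
    have hz' : z = aliveCode x :=
      (codesRel_of_forall_not_refutes (not_exists.2 hcon.2)).codes.unique (codes_aliveCode hal)
    exact hcon.1 (hz' ▸ Set.mem_iInter.1 hz (i + 1))

/-- Let V_i be the set of codes z whose unrefuted x all lie in the universal test. Its preimage
among surviving x is contained in the universal test up to unreliable x, so V is a test. A random z
escapes some V_i, which yields an x outside a component of the universal test with code z. -/
theorem exists_codes_of_mem_MLR {z : Seq 3} (hz : z ∈ MLR (lebesgue 3)) :
    ∃ x ∈ MLR (lebesgue 3), Codes x z := by
  have hU := isMLTest_universalTest 3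
  let B : ℕ → List (Fin 3) → List (Fin 3) → Prop := fun i t s => Refutes (i + 2) s t
  have hA : PrimrecPred fun _ : ℕ × List (Fin 3) => True :=
    ⟨fun _ => inferInstance, Primrec.const _⟩
  have hB : PrimrecPred fun p : (ℕ × List (Fin 3)) × List (Fin 3) => B p.1.1 p.1.2 p.2 :=
    primrecPred_refutes.comp
      ((Primrec.nat_add.comp (Primrec.fst.comp Primrec.fst) (Primrec.const 2)).pair
        (Primrec.snd.pair (Primrec.snd.comp Primrec.fst)))
  have hV := uniformlySigma01_forall hU.uniform 2 (A := fun _ _ => True) hA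
    (fun _ _ _ _ _ h => h) hB (fun i z x m l hml => Refutes.mono hml)
  have htest : IsMLTest (lebesgue 3) _ := ⟨hV, fun i => by
    set V : Set (Seq 3) := {z : Seq 3 | (∃ _m : ℕ, True) ∧
      ∀ x, x ∈ universalTest 3 (i + 2) ∨ ∃ m, B i (initSeg z m) (initSeg x m)} with hVdef
    have hsub : {x | Alive x []} ∩ aliveCode ⁻¹' V ⊆
        {x | ¬Reliable (i + 2) x} ∪ universalTest 3 (i + 2) := by
      rintro x ⟨hal, -, h⟩
      by_cases hr : Reliable (i + 2) x
      · refine Or.inr ((h x).resolve_right ?_)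
        exact not_exists.2 (codesRel_iff.1 ((codes_aliveCode hal).codesRel hr))
      · exact Or.inl hr
    have h1 : ENNReal.ofReal (3 / 4) * lebesgue 3 V ≤ (2⁻¹ : ℝ≥0∞) ^ (i + 1) := by
      rw [← measure_alive_inter_preimage (hV.measurableSet i), ← inv_two_pow_succ_add]
      exact (measure_mono hsub).trans ((measure_union_le _ _).trans
        (add_le_add (measure_not_reliable _) (hU.small _)))
    -- The shift by 2 is spent here: one unit on adding two error terms, one on the factor 3/4 ≥
    -- 1/2.
    have h2 : 2⁻¹ * lebesgue 3 V ≤ 2⁻¹ * (2⁻¹ : ℝ≥0∞) ^ i := by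
      rw [← pow_succ']
      exact (mul_le_mul_left inv_two_le_ofReal _).trans h1
    exact (ENNReal.mul_le_mul_iff_right (by simp) (by simp)).1 h2⟩
  have := hz _ htest
  simp only [Set.mem_iInter, not_forall] at this
  obtain ⟨i, hi⟩ := this
  have : ∃ x, x ∉ universalTest 3 (i + 2) ∧ ¬∃ m, B i (initSeg z m) (initSeg x m) := by
    by_contra! hcon
    exact hi ⟨⟨0, trivial⟩, fun x => or_iff_not_imp_left.2 (hcon x)⟩
  obtain ⟨x, hx, hR⟩ := this
  exact ⟨x, mem_MLR_of_notMem_universalTest hx, (codesRel_of_forall_not_refutes hR).codes⟩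

/-! ### Zero sets of random continuous functions -/

theorem exists_pseudoDistance_iff {C : Set (Seq 2)} (hne : C.Nonempty) :
    (∃ δ : Seq 2 → Seq 2, IsRandomContinuousFunction (δ : Seq 2 →. Seq 2) ∧
      IsPseudoDistance δ C) ↔ IsRandomClosedSet C := by
  constructor
  · rintro ⟨δ, ⟨x, hx, hδ⟩, hC⟩
    have hzero : C = {y | ∀ k, labelSeq x y k ≠ 1} := by
      rw [hC]
      ext y
      have hy : Part.some (δ y) = codedFun x y := congrFun hδ y
      have hdom : (codedFun x y).Dom := hy ▸ trivial
      have hget : (codedFun x y).get hdom = δ y := by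
        rw [Part.get_eq_iff_mem, ← hy]
        exact Part.mem_some _
      simp only [Set.mem_ofPred_eq]
      rw [← hget, codedFun_get_eq_zero]
    obtain ⟨y, hy⟩ := hne
    rw [hzero] at hy
    -- A zero of δ is an infinite path free of the label 1, so nonemptiness of C puts x in the event
    -- where `aliveCode` is meaningful.
    have hal : Alive x [] := alive_initSeg hy 0
    exact ⟨aliveCode x, aliveCode_mem_MLR hx hal, by rw [hzero, (codes_aliveCode hal).paths_eq]⟩
  · rintro ⟨z, hz, rfl⟩
    obtain ⟨x, hx, hxz⟩ := exists_codes_of_mem_MLR hz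
    have hdom : ∀ y, (codedFun x y).Dom := infinite_labelSeq_ne_two hx
    refine ⟨fun y => (codedFun x y).get (hdom y), ⟨x, hx, ?_⟩, ?_⟩
    · funext y
      exact Part.some_get (hdom y)
    · rw [IsPseudoDistance, hxz.paths_eq]
      ext y
      simp only [Set.mem_ofPred_eq, codedFun_get_eq_zero]

end AlgRandom

theorem mainTheorem3 (C : Set (AlgRandom.Seq 2)) (hclosed : IsClosed C) (hne : C.Nonempty) :
    (∃ δ : AlgRandom.Seq 2 → AlgRandom.Seq 2,
        AlgRandom.IsRandomContinuousFunction (δ : AlgRandom.Seq 2 →. AlgRandom.Seq 2) ∧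
          AlgRandom.IsPseudoDistance δ C) ↔
      AlgRandom.IsRandomClosedSet C :=
  AlgRandom.exists_pseudoDistance_iff hne
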